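/- **Setting.** For $n\ge 1$ let $A=(b_{ij}g_{ij})_{1\le i,j\le n}$, where the $b_{ij}$ are fixed (real or complex) scalars and the $g_{ij}$ are i.i.d. random variables, and let $\rho(A)$ be the spectral radius of $A$ (the largest modulus of a complex eigenvalue). Put $$\sigma:=\max\Big(\max_{i}\sqrt{\sum_{j=1}^n|b_{ij}|^2},\ \max_{j}\sqrt{\sum_{i=1}^n|b_{ij}|^2}\Big),\qquad \sigma_*:=\max_{i,j}|b_{ij}|,$$ with the convention $\sigma/\sigma_*=0$ and $0/0=0$ if all $b_{ij}$ vanish. Consider the following two cases for the common law of the $g_{ij}$. * (Gaussian case) It is the standard real Gaussian law $\mathcal N_{\mathbb R}(0,1)$ or the standard complex Gaussian law $\mathcal N_{\mathbb C}(0,1)$. * (Symmetric sub-Gaussian case with constant $K>0$) It satisfies $\mathbb E[g]=0$, $\mathbb E[|g|^2]=1$, $g\overset{\text{law}}{=}-g$, and $\mathbb E[|g|^{2m}]\le (Km)^m$ for every integer $m\ge 1$; moreover either $g$ is real-valued, or the law of $g$ is invariant under all rotations $z\mapsto e^{i\theta}z$ of the complex plane. **Theorem.** In each of these cases the following two statements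 hold. 1. There is a constant $C>0$, universal in the Gaussian case and depending only on $K$ in the sub-Gaussian case, such that for all $n\ge1$, all $(b_{ij})$ and all $\epsilon>0$, $$\mathbb{E}[\rho(A)]\le (1+\epsilon)\left(\sigma+\frac{6\sigma_*}{\sqrt{\log(1+\epsilon)}}\sqrt{\log n}\right)\left(1+C\,\frac{\sqrt{6\frac{\log n}{\log(1+\epsilon)}}}{\sqrt{\left(\frac{\sigma}{\sigma_*}\right)^2+6\frac{\log n}{\log(1+\epsilon)}}}\right).$$ 2. For each $n$ let $A_n$ be an $n\times n$ random matrix as above, with parameters $\sigma_n$ and $\sigma_{*,n}$, all $A_n$ being defined on one probability space with an arbitrary joint distribution (the laws of their entries may vary with $n$ within the case considered, with the same $K$). If $\sigma_{*,n}=o\big((\log n)^{-1/2}\big)$ as $n\to\infty$, then $$\mathbb P\Big(\limsup_{n\to\infty}\rho(A_n)>\limsup_{n\to\infty}\sigma_n\Big)=0.$$ In particular, if $\sigma_n=\sigma$ for all $n$, then $\mathbb P(\limsup_{n\to\infty}\rho(A_n)>\sigma)=0$. -/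

import Mathlib

open MeasureTheory ProbabilityTheory Filter Asymptotics
open scoped ENNReal NNReal Topology

universe u

namespace SpectralRadiusBound

noncomputable section

/-- The standard real Gaussian distribution, as a law on `ℂ` carried by the real axis. -/
def stdRealGaussian : Measure ℂ :=
  (gaussianReal 0 1).map (fun x : ℝ => (x : ℂ))

/-- The standard complex Gaussian distribution: the law of `X + iY` with `X`, `Y` independent
centered real Gaussians of variance `1/2`. -/
def stdComplexGaussian : Measure ℂ :=
  ((gaussianReal 0 (1 / 2)).prod (gaussianReal 0 (1 / 2))).map
    (fun p : ℝ × ℝ => (p.1 : ℂ) + (p.2 : ℂ) * Complex.I)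

/-- The two standard Gaussian laws. -/
def gaussianLaws : Set (Measure ℂ) := {stdRealGaussian, stdComplexGaussian}

/-- Centered, unit variance, symmetric laws with sub-Gaussian moments (with constant `K`), which
are carried by the real axis or invariant under all rotations of the complex plane. -/
structure IsSymmSubGaussianLaw (K : ℝ) (μ : Measure ℂ) : Prop where
  isProbabilityMeasure : IsProbabilityMeasure μ
  mean_zero : ∫ z, z ∂μ = 0
  unit_variance : ∫ z, ‖z‖ ^ 2 ∂μ = 1
  symmetric : μ.map (fun z => -z) = μ
  moment_le : ∀ m : ℕ, 1 ≤ m →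
    ∫⁻ z, ‖z‖ₑ ^ (2 * m) ∂μ ≤ ENNReal.ofReal ((K * m) ^ m)
  real_or_rotation_invariant :
    (∀ᵐ z ∂μ, z.im = 0) ∨
      ∀ θ : ℝ, μ.map (fun z => Complex.exp (θ * Complex.I) * z) = μ

/-- The class of laws above, for a given sub-Gaussian constant `K`. -/
def subGaussianLaws (K : ℝ) : Set (Measure ℂ) := {μ | IsSymmSubGaussianLaw K μ}

/-- `g` is an array of independent random variables which all have law `μ`. -/
structure IsIIDArray {Ω : Type*} [MeasurableSpace Ω] (P : Measure Ω) (μ : Measure ℂ) {n : ℕ}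
    (g : Fin n → Fin n → Ω → ℂ) : Prop where
  hasLaw : ∀ i j, HasLaw (g i j) μ P
  indep : iIndepFun (fun p : Fin n × Fin n => g p.1 p.2) P

/-- The random matrix with entries `b i j * g i j`. -/
def randomMatrix {Ω : Type*} {n : ℕ} (b : Fin n → Fin n → ℂ) (g : Fin n → Fin n → Ω → ℂ)
    (ω : Ω) : Matrix (Fin n) (Fin n) ℂ :=
  Matrix.of fun i j => b i j * g i j ω

/-- `σ`: the largest Euclidean norm of a row or a column of `b`. -/
def sigma {n : ℕ} (b : Fin n → Fin n → ℂ) : ℝ :=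
  max (⨆ i, √(∑ j, ‖b i j‖ ^ 2)) (⨆ j, √(∑ i, ‖b i j‖ ^ 2))

/-- `σ_*`: the largest modulus of an entry of `b`. -/
def sigmaStar {n : ℕ} (b : Fin n → Fin n → ℂ) : ℝ :=
  ⨆ i, ⨆ j, ‖b i j‖

end

end SpectralRadiusBound

open SpectralRadiusBound

/-! Moment method for powers of `A`. In the Frobenius norm, ρ(A)^(2p) ≤ n‖A^p‖², and E‖A^p‖² is a
sum over pairs of walks of length p leaving a common vertex, weighted by mixed moments of the
entries. Odd moments vanish by symmetry, and even ones are dominated by weighted pairing counts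
(`HasSubGaussianMoments.norm_integral_monomial_le`). A pair of walks thus becomes an exploration:
each step opens an occurrence of a directed edge or closes one that is open.

The weighted number of completions of a state is at most R^(remaining steps) times a potential, a
product over vertices (`sum_step_potential_le`, `walkSum_edgeWeight_le`). The leading constant is σ
because edges are directed: the two occurrences of a pair leave the same vertex. At a vertex without
open exits only openings are possible, of total weight about σ; at a vertex with open exits the
closings contribute σ, and openings are damped by a small δ. Openings towards vertices already
entered lack the gain of a full row sum, but there are at most about 2p of them, each of weight at
most a constant times σ_*². Optimizing δ gives R = σ + C√p σ_* (`walkSum_edgeWeight_zero_le`).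

Hence E ρ(A)^(2p) ≤ n²(σ + C√p σ_*)^(2p). With p about log n / log(1+ε), Jensen's inequality gives
the bound on the mean. With p a large multiple of log n, Markov's inequality and Borel–Cantelli give
the almost sure statement. -/

namespace SpectralRadiusBound

/-! ### Pairing counts as upper bounds for moments -/

/-- The weighted number of ways to process `k` further occurrences of one edge so that every
occurrence is either opened (weight `β`, and an extra `K` from the second opening on) or closes one
of the open occurrences; `o` occurrences are currently open, `m` have been opened so far. -/
def pairWeight (β K : ℝ) : ℕ → ℕ → ℕ → ℝ
  | 0, o, _ => if o = 0 then 1 else 0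
  | k + 1, o, m => β * (if m = 0 then 1 else K) * pairWeight β K k (o + 1) (m + 1) +
      o * pairWeight β K k (o - 1) m

theorem pairWeight_nonneg {β K : ℝ} (hβ : 0 ≤ β) (hK : 0 ≤ K) (k o m : ℕ) :
    0 ≤ pairWeight β K k o m := by
  induction k generalizing o m with
  | zero => unfold pairWeight; split_ifs <;> norm_num
  | succ k ih =>
    have h1 := ih (o + 1) (m + 1)
    have h2 := ih (o - 1) m
    have h3 : (0 : ℝ) ≤ if m = 0 then 1 else K := by split_ifs <;> [norm_num; exact hK]
    rw [pairWeight]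
    positivity

/-- Placing the closings of `o` labelled open occurrences among `k` positions and pairing the other
`2 * j` positions can be done in k!/(2^j j!) ways. In the induction, `k + 1 = o + 2 * j` splits the
factorial between closing and opening. Since `1 ≤ m`, each opening carries the factor `K`. -/
theorem factorial_div_le_pairWeight {β K : ℝ} (hβ : 0 ≤ β) (hK : 0 ≤ K) (k : ℕ) :
    ∀ o m j : ℕ, k = o + 2 * j → 1 ≤ m →
      (K * β) ^ j * (k.factorial / (2 ^ j * j.factorial)) ≤ pairWeight β K k o m := by
  induction k with
  | zero =>
    intro o m j hk hm
    obtain ⟨rfl, rfl⟩ : o = 0 ∧ j = 0 := by omega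
    simp [pairWeight]
  | succ k ih =>
    intro o m j hk hm
    rw [pairWeight, if_neg (by omega)]
    have hA : (K * β) ^ j * (2 * j * (k.factorial / (2 ^ j * j.factorial))) ≤
        β * K * pairWeight β K k (o + 1) (m + 1) := by
      rcases j with _ | j
      · have := pairWeight_nonneg hβ hK k (o + 1) (m + 1)
        simp only [pow_zero, Nat.cast_zero, mul_zero, zero_mul]
        positivity
      · have h := mul_le_mul_of_nonneg_left (ih (o + 1) (m + 1) j (by omega) (by omega))
          (mul_nonneg hβ hK)
        refine le_trans (le_of_eq ?_) h
        rw [Nat.factorial_succ]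
        have : (j.factorial : ℝ) ≠ 0 := by positivity
        push_cast
        field_simp
        ring
    have hB : (K * β) ^ j * (o * (k.factorial / (2 ^ j * j.factorial))) ≤
        o * pairWeight β K k (o - 1) m := by
      rcases o with _ | o
      · simp
      · have h := mul_le_mul_of_nonneg_left (ih o m j (by omega) hm)
          (Nat.cast_nonneg (α := ℝ) (o + 1))
        refine le_trans (le_of_eq ?_) h
        ring
    refine le_trans (le_of_eq ?_) (add_le_add hA hB)
    rw [Nat.factorial_succ]
    have : (k : ℝ) + 1 = o + 2 * j := by exact_mod_cast hk
    push_cast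
    rw [this]
    ring

/-- The first occurrence can only open, and does so without the factor `K`; this is why the exponent
of `K` is one less than that of `β`. -/
theorem pow_mul_factorial_div_le_pairWeight {β K : ℝ} (hβ : 0 ≤ β) (hK : 0 ≤ K) (j : ℕ) :
    β ^ (j + 1) * K ^ j * ((2 * (j + 1)).factorial / (2 ^ (j + 1) * (j + 1).factorial)) ≤
      pairWeight β K (2 * (j + 1)) 0 0 := by
  have h := factorial_div_le_pairWeight hβ hK (2 * j + 1) 1 1 j (by ring) le_rfl
  rw [show 2 * (j + 1) = (2 * j + 1) + 1 by ring, pairWeight]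
  simp only [if_true, mul_one, Nat.cast_zero, zero_mul, add_zero, zero_add]
  refine le_trans (le_of_eq ?_) (mul_le_mul_of_nonneg_left h hβ)
  rw [Nat.factorial_succ (2 * j + 1), Nat.factorial_succ j]
  have : (j.factorial : ℝ) ≠ 0 := by positivity
  push_cast
  field_simp
  ring

/-! ### Exploration of pairs of walks and its potential -/

section Walks

variable {ι : Type*} [Fintype ι] [DecidableEq ι]

/-- The sum, over the pairs of walks with `k` steps from `u` and with `l` steps from `x`, of a
function of the vector of edge multiplicities. -/
def walkSum : ℕ → ℕ → ι → ι → ((ι × ι → ℕ) → ℝ) → ℝ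
  | 0, 0, _, _, F => F 0
  | 0, l + 1, u, x, F => ∑ w, walkSum 0 l u w fun c => F (c + Pi.single (x, w) 1)
  | k + 1, l, u, x, F => ∑ w, walkSum k l w x fun c => F (c + Pi.single (u, w) 1)

theorem walkSum_add (k l : ℕ) (u x : ι) (F G : (ι × ι → ℕ) → ℝ) :
    walkSum k l u x (fun c => F c + G c) = walkSum k l u x F + walkSum k l u x G := by
  induction k generalizing u F G with
  | zero =>
    induction l generalizing x F G with
    | zero => simp [walkSum]
    | succ l ih => simp only [walkSum, ih, Finset.sum_add_distrib]
  | succ k ih => simp only [walkSum, ih, Finset.sum_add_distrib]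

theorem walkSum_const_mul (k l : ℕ) (u x : ι) (a : ℝ) (F : (ι × ι → ℕ) → ℝ) :
    walkSum k l u x (fun c => a * F c) = a * walkSum k l u x F := by
  induction k generalizing u F with
  | zero =>
    induction l generalizing x F with
    | zero => simp [walkSum]
    | succ l ih => simp only [walkSum, ih, Finset.mul_sum]
  | succ k ih => simp only [walkSum, ih, Finset.mul_sum]

/-- The factor for a new opening of an edge that has been opened `m` times. -/
def reopenFactor (K : ℝ) (m : ℕ) : ℝ := if m = 0 then 1 else K

/-- The product of the pairing weights of all edges. -/
def edgeWeight (β : ι × ι → ℝ) (K : ℝ) (o m c : ι × ι → ℕ) : ℝ :=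
  ∏ e, pairWeight (β e) K (c e) (o e) (m e)

/-- A step changes the multiplicity of one edge only, so the recursion of `pairWeight` for that edge
becomes the open/close alternative of the exploration. -/
theorem edgeWeight_add_single (β : ι × ι → ℝ) (K : ℝ) (o m c : ι × ι → ℕ) (e : ι × ι) :
    edgeWeight β K o m (c + Pi.single e 1) =
      β e * reopenFactor K (m e) *
          edgeWeight β K (o + Pi.single e 1) (m + Pi.single e 1) c +
        o e * edgeWeight β K (o - Pi.single e 1) m c := by
  unfold edgeWeight
  rw [← Finset.mul_prod_erase _ _ (Finset.mem_univ e), ← Finset.mul_prod_erase _ _ (Finset.mem_univ e),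
    ← Finset.mul_prod_erase _ _ (Finset.mem_univ e)]
  have h1 : ∀ f ∈ Finset.univ.erase e, pairWeight (β f) K ((c + Pi.single e 1 : ι × ι → ℕ) f) (o f) (m f) =
      pairWeight (β f) K (c f) (o f) (m f) := by
    intro f hf; simp [Finset.ne_of_mem_erase hf]
  have h2 : ∀ f ∈ Finset.univ.erase e, pairWeight (β f) K (c f) ((o + Pi.single e 1 : ι × ι → ℕ) f)
      ((m + Pi.single e 1 : ι × ι → ℕ) f) = pairWeight (β f) K (c f) (o f) (m f) := by
    intro f hf; simp [Finset.ne_of_mem_erase hf]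
  have h3 : ∀ f ∈ Finset.univ.erase e, pairWeight (β f) K (c f) ((o - Pi.single e 1 : ι × ι → ℕ) f) (m f) =
      pairWeight (β f) K (c f) (o f) (m f) := by
    intro f hf; simp [Finset.ne_of_mem_erase hf]
  rw [Finset.prod_congr rfl h1, Finset.prod_congr rfl h2, Finset.prod_congr rfl h3]
  simp only [Pi.add_apply, Pi.sub_apply, Pi.single_eq_same, pairWeight, reopenFactor]
  ring

/-- Number of edges, counted by `f`, which leave `v`. -/
def outCount (f : ι × ι → ℕ) (v : ι) : ℕ := ∑ w, f (v, w)

/-- Number of edges, counted by `f`, which enter `v`. -/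
def inCount (f : ι × ι → ℕ) (v : ι) : ℕ := ∑ w, f (w, v)

theorem outCount_add_single (f : ι × ι → ℕ) (u w v : ι) :
    outCount (f + Pi.single (u, w) 1) v = outCount f v + if v = u then 1 else 0 := by
  simp only [outCount, Pi.add_apply, Finset.sum_add_distrib, Pi.single_apply, Prod.mk.injEq]
  by_cases h : v = u <;> simp [h]

theorem inCount_add_single (f : ι × ι → ℕ) (u w v : ι) :
    inCount (f + Pi.single (u, w) 1) v = inCount f v + if v = w then 1 else 0 := by
  simp only [inCount, Pi.add_apply, Finset.sum_add_distrib, Pi.single_apply, Prod.mk.injEq]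
  by_cases h : v = w <;> simp [h]

omit [Fintype ι] in
theorem sub_single_add_single {f : ι × ι → ℕ} {e : ι × ι} (h : f e ≠ 0) :
    f - Pi.single e 1 + Pi.single e 1 = f := by
  funext e'
  by_cases he : e' = e
  · subst he; simp; omega
  · simp [he]

/-- The potential attached to the exits of a vertex with `q` open and `d` opened exits. -/
noncomputable def exitPotential (s δ : ℝ) (q d : ℕ) : ℝ :=
  q.factorial * s⁻¹ ^ q * ((δ / 2) ^ (d - 1) / (d - 1).factorial)

/-- The potential attached to the entrances of a vertex with `c` opened entrances. -/
noncomputable def entrancePotential (δ : ℝ) (c : ℕ) : ℝ :=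
  (c - 1).factorial * (2 / δ) ^ (c - 1)

/-- Opened entrances, where a pair of walks starts at `r`. -/
def entranceCount (r : ι) (m : ι × ι → ℕ) (v : ι) : ℕ := (if v = r then 1 else 0) + inCount m v

/-- The potential of a state of the exploration. -/
noncomputable def potential (s δ : ℝ) (r : ι) (o m : ι × ι → ℕ) : ℝ :=
  (∏ v, exitPotential s δ (outCount o v) (outCount m v)) *
    ∏ v, entrancePotential δ (entranceCount r m v)

variable {s δ : ℝ}

theorem exitPotential_pos (hs : 0 < s) (hδ : 0 < δ) (q d : ℕ) : 0 < exitPotential s δ q d := by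
  unfold exitPotential; positivity

theorem entrancePotential_pos (hδ : 0 < δ) (c : ℕ) : 0 < entrancePotential δ c := by
  unfold entrancePotential; positivity

theorem potential_pos (hs : 0 < s) (hδ : 0 < δ) (r : ι) (o m : ι × ι → ℕ) :
    0 < potential s δ r o m :=
  mul_pos (Finset.prod_pos fun _ _ => exitPotential_pos hs hδ _ _)
    (Finset.prod_pos fun _ _ => entrancePotential_pos hδ _)

/-- The gain factor for opening an exit, when `d` exits have been opened. -/
noncomputable def exitGain (δ : ℝ) (d : ℕ) : ℝ := if d = 0 then 1 else δ

/-- For `d ≥ 1` the ratio of the two potentials is (q+1)δ/(2ds), and q + 1 ≤ 2d; the half in `δ / 2`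
is there to absorb this 2. -/
theorem exitPotential_succ_le (hs : 0 < s) (hδ : 0 < δ) {q d : ℕ} (h : q ≤ d) :
    exitPotential s δ (q + 1) (d + 1) ≤ exitGain δ d / s * exitPotential s δ q d := by
  unfold exitPotential exitGain
  rcases d with _ | d
  · obtain rfl : q = 0 := by omega
    simp
  · rw [if_neg (by omega)]
    simp only [Nat.add_sub_cancel, Nat.factorial_succ, pow_succ]
    have hq : ((q : ℝ) + 1) ≤ 2 * (d + 1) := by
      have : (q : ℝ) ≤ d + 1 := by exact_mod_cast h
      nlinarith [Nat.cast_nonneg (α := ℝ) d]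
    push_cast
    have h0 : (d.factorial : ℝ) ≠ 0 := by positivity
    calc ((q : ℝ) + 1) * q.factorial * (s⁻¹ ^ q * s⁻¹) *
          ((δ / 2) ^ d * (δ / 2) / ((d + 1) * d.factorial))
        = (((q : ℝ) + 1) / (2 * (d + 1))) * (δ / s *
          (q.factorial * s⁻¹ ^ q * ((δ / 2) ^ d / d.factorial))) := by field_simp
      _ ≤ 1 * (δ / s * (q.factorial * s⁻¹ ^ q * ((δ / 2) ^ d / d.factorial))) := by
          apply mul_le_mul_of_nonneg_right _ (by positivity)
          rw [div_le_one (by positivity)]; exact hq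
      _ = _ := by rw [one_mul]

theorem exitPotential_close (hs : 0 < s) (q d : ℕ) :
    (q + 1) * exitPotential s δ q d = s * exitPotential s δ (q + 1) d := by
  unfold exitPotential
  rw [Nat.factorial_succ, pow_succ]
  push_cast
  field_simp

theorem entrancePotential_succ (c : ℕ) :
    entrancePotential δ (c + 1) = (if c = 0 then 1 else 2 / δ * c) * entrancePotential δ c := by
  unfold entrancePotential
  rcases c with _ | c
  · simp
  · rw [if_neg (by omega)]
    simp only [Nat.add_sub_cancel, Nat.factorial_succ, pow_succ]
    push_cast
    ring

theorem potential_open_le (hs : 0 < s) (hδ : 0 < δ) (r : ι) {o m : ι × ι → ℕ} (h : o ≤ m)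
    (u w : ι) :
    potential s δ r (o + Pi.single (u, w) 1) (m + Pi.single (u, w) 1) ≤
      exitGain δ (outCount m u) / s *
        (if entranceCount r m w = 0 then 1 else 2 / δ * entranceCount r m w) *
          potential s δ r o m := by
  unfold potential
  have hent : ∀ v, entranceCount r (m + Pi.single (u, w) 1) v =
      entranceCount r m v + if v = w then 1 else 0 := by
    intro v; simp only [entranceCount, inCount_add_single]; ring
  simp only [outCount_add_single, hent]
  rw [← Finset.mul_prod_erase _ _ (Finset.mem_univ u), ← Finset.mul_prod_erase _ _ (Finset.mem_univ w)]
  rw [← Finset.mul_prod_erase Finset.univ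
      (fun v => exitPotential s δ (outCount o v) (outCount m v)) (Finset.mem_univ u),
    ← Finset.mul_prod_erase Finset.univ
      (fun v => entrancePotential δ (entranceCount r m v)) (Finset.mem_univ w)]
  have h1 : ∀ v ∈ Finset.univ.erase u, exitPotential s δ (outCount o v + if v = u then 1 else 0)
      (outCount m v + if v = u then 1 else 0) = exitPotential s δ (outCount o v) (outCount m v) := by
    intro v hv; simp [Finset.ne_of_mem_erase hv]
  have h2 : ∀ v ∈ Finset.univ.erase w, entrancePotential δ
      (entranceCount r m v + if v = w then 1 else 0) =
        entrancePotential δ (entranceCount r m v) := by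
    intro v hv; simp [Finset.ne_of_mem_erase hv]
  rw [Finset.prod_congr rfl h1, Finset.prod_congr rfl h2]
  simp only [if_true, entrancePotential_succ]
  have hq : outCount o u ≤ outCount m u := Finset.sum_le_sum fun w _ => h _
  have h3 := exitPotential_succ_le hs hδ hq
  set A := ∏ v ∈ Finset.univ.erase u, exitPotential s δ (outCount o v) (outCount m v) with hA
  set B := ∏ v ∈ Finset.univ.erase w, entrancePotential δ (entranceCount r m v) with hB
  have hA0 : 0 ≤ A := Finset.prod_nonneg fun _ _ => (exitPotential_pos hs hδ _ _).le
  have hB0 : 0 ≤ B := Finset.prod_nonneg fun _ _ => (entrancePotential_pos hδ _).le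
  have hE := (entrancePotential_pos hδ (entranceCount r m w)).le
  have hg : (0 : ℝ) ≤ if entranceCount r m w = 0 then 1 else 2 / δ * entranceCount r m w := by
    split_ifs <;> positivity
  set G : ℝ := if entranceCount r m w = 0 then 1 else 2 / δ * entranceCount r m w
  calc _ = exitPotential s δ (outCount o u + 1) (outCount m u + 1) *
        (A * (G * entrancePotential δ (entranceCount r m w) * B)) := by ring
    _ ≤ exitGain δ (outCount m u) / s * exitPotential s δ (outCount o u) (outCount m u) *
        (A * (G * entrancePotential δ (entranceCount r m w) * B)) :=
        mul_le_mul_of_nonneg_right h3 (by positivity)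
    _ = _ := by ring

/-- The factor q! s^(-q) is designed for this: all the closings available at `u` together cost
exactly `s`, however many exits are open. -/
theorem potential_close (hs : 0 < s) (r : ι) {o m : ι × ι → ℕ} {u w : ι} (h : o (u, w) ≠ 0) :
    outCount o u * potential s δ r (o - Pi.single (u, w) 1) m = s * potential s δ r o m := by
  obtain ⟨o', rfl⟩ : ∃ o' : ι × ι → ℕ, o = o' + Pi.single (u, w) 1 := ⟨_, (sub_single_add_single h).symm⟩
  rw [add_tsub_cancel_right]
  unfold potential
  simp only [outCount_add_single]
  rw [← Finset.mul_prod_erase Finset.univ (fun v => exitPotential s δ (outCount o' v)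
      (outCount m v)) (Finset.mem_univ u)]
  rw [← Finset.mul_prod_erase Finset.univ (fun v => exitPotential s δ
      (outCount o' v + if v = u then 1 else 0) (outCount m v)) (Finset.mem_univ u)]
  have h1 : ∀ v ∈ Finset.univ.erase u, exitPotential s δ (outCount o' v + if v = u then 1 else 0)
      (outCount m v) = exitPotential s δ (outCount o' v) (outCount m v) := by
    intro v hv; simp [Finset.ne_of_mem_erase hv]
  rw [Finset.prod_congr rfl h1]
  simp only [if_true]
  have := exitPotential_close (δ := δ) hs (outCount o' u) (outCount m u)
  push_cast
  rw [← mul_assoc, ← mul_assoc, this]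
  ring

theorem sum_entranceCount (r : ι) (m : ι × ι → ℕ) :
    ∑ v, entranceCount r m v = 1 + ∑ e, m e := by
  simp only [entranceCount, inCount, Finset.sum_add_distrib, Finset.sum_ite_eq', Finset.mem_univ,
    if_true, Fintype.sum_prod_type]
  rw [Finset.sum_comm]

/-- One step of the exploration multiplies the potential by at most a constant. -/
theorem sum_step_potential_le {β : ι × ι → ℝ} {K τ B : ℝ} {N : ℕ} (hs : 0 < s) (hδ : 0 < δ)
    (hδ1 : δ ≤ 1) (hβ : ∀ e, 0 ≤ β e) (hK : 1 ≤ K) (hrow : ∀ v, ∑ w, β (v, w) ≤ τ)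
    (hτ : τ ≤ s ^ 2) (hB : ∀ e, β e ≤ B) (r u : ι) {o m : ι × ι → ℕ} (h : o ≤ m)
    (hN : 1 + ∑ e, m e ≤ N) :
    ∑ w, (β (u, w) * reopenFactor K (m (u, w)) *
          potential s δ r (o + Pi.single (u, w) 1) (m + Pi.single (u, w) 1) +
        o (u, w) * potential s δ r (o - Pi.single (u, w) 1) m) ≤
      (s + δ * s + 2 * K * B * N / (δ * s)) * potential s δ r o m := by
  set V := potential s δ r o m with hV
  have hV0 : 0 < V := potential_pos hs hδ r o m
  set θ := exitGain δ (outCount m u) with hθ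
  have hθ0 : 0 ≤ θ := by rw [hθ]; unfold exitGain; split_ifs <;> linarith
  have hθ1 : θ ≤ 1 := by rw [hθ]; unfold exitGain; split_ifs <;> linarith
  have hB0 : 0 ≤ B := (hβ (u, u)).trans (hB (u, u))
  have hopen : ∀ w, β (u, w) * reopenFactor K (m (u, w)) *
      potential s δ r (o + Pi.single (u, w) 1) (m + Pi.single (u, w) 1) ≤
      θ / s * V * (β (u, w) + 2 * K * B / δ * entranceCount r m w) := by
    intro w
    have h1 := potential_open_le hs hδ r h u w
    have hr0 : 0 ≤ reopenFactor K (m (u, w)) := by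
      unfold reopenFactor; split_ifs <;> linarith
    refine (mul_le_mul_of_nonneg_left h1 (mul_nonneg (hβ _) hr0)).trans ?_
    rw [← hθ, ← hV]
    have hc : 0 ≤ θ / s * V := by positivity
    by_cases hc0 : entranceCount r m w = 0
    -- A target never entered cannot be the head of an opened edge, so `K` is absent and the weight
    -- is the bare `β`. For a target already entered, `β` and the reopening factor are replaced by
    -- `B * K`.
    · have hm0 : m (u, w) = 0 := by
        have : m (u, w) ≤ entranceCount r m w := by
          unfold entranceCount inCount
          exact (Finset.single_le_sum (f := fun v => m (v, w)) (fun _ _ => Nat.zero_le _)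
            (Finset.mem_univ u)).trans (Nat.le_add_left _ _)
        omega
      simp only [hc0, hm0, reopenFactor, if_true, Nat.cast_zero, mul_zero, add_zero]
      exact le_of_eq (by ring)
    · rw [if_neg hc0]
      have hrK : reopenFactor K (m (u, w)) ≤ K := by
        unfold reopenFactor; split_ifs <;> linarith
      have h2 : β (u, w) * reopenFactor K (m (u, w)) ≤ B * K :=
        mul_le_mul (hB _) hrK hr0 hB0
      calc _ = (θ / s * V) * (2 / δ * entranceCount r m w) *
            (β (u, w) * reopenFactor K (m (u, w))) := by ring
        _ ≤ (θ / s * V) * (2 / δ * entranceCount r m w) * (B * K) :=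
            mul_le_mul_of_nonneg_left h2 (by positivity)
        _ = θ / s * V * (0 + 2 * K * B / δ * entranceCount r m w) := by ring
        _ ≤ _ := by gcongr; exact hβ _
  have hopen' : ∑ w, β (u, w) * reopenFactor K (m (u, w)) *
      potential s δ r (o + Pi.single (u, w) 1) (m + Pi.single (u, w) 1) ≤
      (θ * s + 2 * K * B * N / (δ * s)) * V := by
    refine (Finset.sum_le_sum fun w _ => hopen w).trans ?_
    rw [← Finset.mul_sum, Finset.sum_add_distrib, ← Finset.mul_sum]
    have hcount : (∑ w, (entranceCount r m w : ℝ)) ≤ N := by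
      have := sum_entranceCount r m
      exact_mod_cast this.trans_le hN
    calc _ ≤ θ / s * V * (s ^ 2 + 2 * K * B / δ * N) := by
            gcongr
            exact (hrow u).trans hτ
      _ = θ * s * V + θ * (2 * K * B * N / (δ * s) * V) := by field_simp
      _ ≤ θ * s * V + 1 * (2 * K * B * N / (δ * s) * V) := by gcongr
      _ = _ := by ring
  have hclose : ∑ w, o (u, w) * potential s δ r (o - Pi.single (u, w) 1) m =
      if outCount o u = 0 then 0 else s * V := by
    have hterm : ∀ w, (outCount o u : ℝ) * (o (u, w) * potential s δ r (o - Pi.single (u, w) 1) m) =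
        o (u, w) * (s * V) := by
      intro w
      by_cases hw : o (u, w) = 0
      · simp [hw]
      · rw [mul_left_comm, potential_close hs r hw]
    have hsum : (outCount o u : ℝ) * ∑ w, o (u, w) * potential s δ r (o - Pi.single (u, w) 1) m =
        outCount o u * (s * V) := by
      rw [Finset.mul_sum, Finset.sum_congr rfl fun w _ => hterm w, ← Finset.sum_mul]
      simp [outCount]
    split_ifs with h0
    · have : ∀ w, o (u, w) = 0 := by
        intro w
        exact (Finset.sum_eq_zero_iff.1 h0) w (Finset.mem_univ w)
      simp [this]
    · exact mul_left_cancel₀ (by exact_mod_cast h0) hsum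
  rw [Finset.sum_add_distrib, hclose]
  refine (add_le_add_left hopen' _).trans ?_
  have hR : 0 ≤ 2 * K * B * N / (δ * s) * V := by positivity
  -- Without open exits there is no closing term and `θ ≤ 1` suffices. With an open exit some exit
  -- has been opened, hence `θ = δ`. The two contributions of size `s` never occur together.
  split_ifs with h0
  · have : θ * s * V ≤ 1 * s * V := by gcongr
    have : 0 ≤ δ * s * V := by positivity
    linarith
  · have : θ = δ := by
      rw [hθ, exitGain, if_neg]
      intro hd
      have : outCount o u ≤ outCount m u := Finset.sum_le_sum fun w _ => h _
      omega
    rw [this]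
    linarith

end Walks

/-! ### Induction along the walks -/

section WalkBound

variable {ι : Type*} [Fintype ι] [DecidableEq ι] {s δ : ℝ}

/-- For `c = d` the two factors are reciprocal, and the entrance factor does not decrease when `c`
grows. -/
theorem one_le_exitPotential_mul_entrancePotential (hδ : 0 < δ) (hδ1 : δ ≤ 1) {d c : ℕ}
    (h : d ≤ c) : 1 ≤ exitPotential s δ 0 d * entrancePotential δ c := by
  unfold exitPotential entrancePotential
  have h1 : ((d - 1).factorial : ℝ) ≤ (c - 1).factorial := by
    exact_mod_cast Nat.factorial_le (by omega)
  have h2 : (2 / δ) ^ (d - 1) ≤ (2 / δ) ^ (c - 1) := by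
    apply pow_le_pow_right₀ _ (by omega)
    rw [le_div_iff₀ hδ]; linarith
  have h3 : ((d - 1).factorial : ℝ) * (2 / δ) ^ (d - 1) ≤
      (c - 1).factorial * (2 / δ) ^ (c - 1) := by gcongr
  have h0 : 0 < ((d - 1).factorial : ℝ) := by positivity
  have h4 : (δ / 2) ^ (d - 1) / ((d - 1).factorial : ℝ) *
      ((d - 1).factorial * (2 / δ) ^ (d - 1)) = 1 := by
    rw [div_mul_eq_mul_div, mul_left_comm, ← mul_pow]
    rw [show δ / 2 * (2 / δ) = 1 by field_simp]
    field_simp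
    simp
  calc (1 : ℝ) = _ := h4.symm
    _ ≤ (δ / 2) ^ (d - 1) / ((d - 1).factorial : ℝ) * ((c - 1).factorial * (2 / δ) ^ (c - 1)) := by
        gcongr
    _ = _ := by simp

/-- A state with open edges at the end has weight zero. If all are closed, `hbal` says that no
vertex has more opened exits than opened entrances, the start being counted as an entrance. -/
theorem edgeWeight_zero_le_potential {β : ι × ι → ℝ} {K : ℝ} (hs : 0 < s) (hδ : 0 < δ)
    (hδ1 : δ ≤ 1) (r : ι) {o m : ι × ι → ℕ}
    (hbal : ∀ v, 2 * outCount m v + inCount o v ≤ 2 * entranceCount r m v + outCount o v) :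
    edgeWeight β K o m 0 ≤ potential s δ r o m := by
  by_cases ho : o = 0
  · subst ho
    have h1 : edgeWeight β K 0 m 0 = 1 := by simp [edgeWeight, pairWeight]
    rw [h1, potential, ← Finset.prod_mul_distrib]
    have : ∀ v ∈ (Finset.univ : Finset ι), 1 ≤ exitPotential s δ (outCount 0 v) (outCount m v) *
        entrancePotential δ (entranceCount r m v) := by
      intro v _
      have h0 : outCount (0 : ι × ι → ℕ) v = 0 := by simp [outCount]
      have h0' : inCount (0 : ι × ι → ℕ) v = 0 := by simp [inCount]
      have := hbal v
      rw [h0]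
      exact one_le_exitPotential_mul_entrancePotential hδ hδ1 (by omega)
    calc (1 : ℝ) = ∏ v : ι, (1 : ℝ) := by simp
      _ ≤ _ := Finset.prod_le_prod (fun _ _ => zero_le_one) this
  · obtain ⟨e, he⟩ := Function.ne_iff.1 ho
    have : edgeWeight β K o m 0 = 0 := by
      refine Finset.prod_eq_zero (Finset.mem_univ e) ?_
      simpa [pairWeight] using he
    rw [this]
    exact (potential_pos hs hδ r o m).le

theorem walkSum_edgeWeight_succ_left (β : ι × ι → ℝ) (K : ℝ) (k l : ℕ) (u x : ι)
    (o m : ι × ι → ℕ) :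
    walkSum (k + 1) l u x (edgeWeight β K o m) =
      ∑ w, (β (u, w) * reopenFactor K (m (u, w)) *
          walkSum k l w x (edgeWeight β K (o + Pi.single (u, w) 1) (m + Pi.single (u, w) 1)) +
        o (u, w) * walkSum k l w x (edgeWeight β K (o - Pi.single (u, w) 1) m)) := by
  simp only [walkSum, edgeWeight_add_single, walkSum_add, walkSum_const_mul]

theorem walkSum_edgeWeight_succ_right (β : ι × ι → ℝ) (K : ℝ) (l : ℕ) (u x : ι)
    (o m : ι × ι → ℕ) :
    walkSum 0 (l + 1) u x (edgeWeight β K o m) =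
      ∑ w, (β (x, w) * reopenFactor K (m (x, w)) *
          walkSum 0 l u w (edgeWeight β K (o + Pi.single (x, w) 1) (m + Pi.single (x, w) 1)) +
        o (x, w) * walkSum 0 l u w (edgeWeight β K (o - Pi.single (x, w) 1) m)) := by
  simp only [walkSum, edgeWeight_add_single, walkSum_add, walkSum_const_mul]

/-- Inductive step shared by the two walks. The bound after a closing is required only when an open
edge exists, since otherwise the truncated subtraction has no meaning and its coefficient is zero.
-/
theorem sum_le_of_step {β : ι × ι → ℝ} {K R ρ : ℝ} {r x : ι} {o m : ι × ι → ℕ}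
    {S : ι → (ι × ι → ℕ) → (ι × ι → ℕ) → ℝ} (hβ : ∀ e, 0 ≤ β e) (hK : 1 ≤ K) (hρ : 0 ≤ ρ)
    (hopen : ∀ w, S w (o + Pi.single (x, w) 1) (m + Pi.single (x, w) 1) ≤
      ρ * potential s δ r (o + Pi.single (x, w) 1) (m + Pi.single (x, w) 1))
    (hclose : ∀ w, o (x, w) ≠ 0 → S w (o - Pi.single (x, w) 1) m ≤
      ρ * potential s δ r (o - Pi.single (x, w) 1) m)
    (hstep : ∑ w, (β (x, w) * reopenFactor K (m (x, w)) *
          potential s δ r (o + Pi.single (x, w) 1) (m + Pi.single (x, w) 1) +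
        o (x, w) * potential s δ r (o - Pi.single (x, w) 1) m) ≤ R * potential s δ r o m) :
    ∑ w, (β (x, w) * reopenFactor K (m (x, w)) *
          S w (o + Pi.single (x, w) 1) (m + Pi.single (x, w) 1) +
        o (x, w) * S w (o - Pi.single (x, w) 1) m) ≤ ρ * (R * potential s δ r o m) := by
  refine le_trans ?_ (mul_le_mul_of_nonneg_left hstep hρ)
  rw [Finset.mul_sum]
  refine Finset.sum_le_sum fun w _ => ?_
  have h0 : 0 ≤ β (x, w) * reopenFactor K (m (x, w)) := by
    refine mul_nonneg (hβ _) ?_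
    unfold reopenFactor; split_ifs <;> linarith
  rw [mul_add]
  refine add_le_add ((mul_le_mul_of_nonneg_left (hopen w) h0).trans (le_of_eq (by ring))) ?_
  by_cases hw : o (x, w) = 0
  · simp [hw]
  · exact (mul_le_mul_of_nonneg_left (hclose w hw) (Nat.cast_nonneg _)).trans (le_of_eq (by ring))

theorem sum_add_single (m : ι × ι → ℕ) (e : ι × ι) :
    ∑ f, (m + Pi.single e 1 : ι × ι → ℕ) f = ∑ f, m f + 1 := by
  simp [Finset.sum_add_distrib]

/-- The last hypothesis is conservation of flow: `2 * outCount m v - outCount o v` exits have been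
made from `v`, likewise for entrances, and the start `r` counts twice because two walks leave it.
The current position `x` is an entrance not yet followed by an exit. -/
theorem walkSum_zero_edgeWeight_le {β : ι × ι → ℝ} {K τ B : ℝ} {N : ℕ} (hs : 0 < s) (hδ : 0 < δ)
    (hδ1 : δ ≤ 1) (hβ : ∀ e, 0 ≤ β e) (hK : 1 ≤ K) (hrow : ∀ v, ∑ w, β (v, w) ≤ τ)
    (hτ : τ ≤ s ^ 2) (hB : ∀ e, β e ≤ B) (r u : ι) (l : ℕ) :
    ∀ (x : ι) (o m : ι × ι → ℕ), o ≤ m → l + ∑ e, m e ≤ N →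
      (∀ v, 2 * outCount m v + inCount o v + (if v = x then 1 else 0) ≤
        2 * entranceCount r m v + outCount o v) →
      walkSum 0 l u x (edgeWeight β K o m) ≤
        (s + δ * s + 2 * K * B * N / (δ * s)) ^ l * potential s δ r o m := by
  have hB0 : 0 ≤ B := (hβ (u, u)).trans (hB (u, u))
  induction l with
  | zero =>
    intro x o m hom hN hbal
    rw [pow_zero, one_mul]
    rw [walkSum]
    exact edgeWeight_zero_le_potential hs hδ hδ1 r fun v => by have := hbal v; omega
  | succ l ih =>
    intro x o m hom hN hbal
    rw [walkSum_edgeWeight_succ_right, pow_succ, mul_assoc]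
    refine sum_le_of_step (S := fun w o m => walkSum 0 l u w (edgeWeight β K o m)) hβ hK
      (by positivity) (fun w => ?_) (fun w hw => ?_)
      (sum_step_potential_le hs hδ hδ1 hβ hK hrow hτ hB r x hom (by omega))
    · refine ih w _ _ (add_le_add_left hom _) (by rw [sum_add_single]; omega) fun v => ?_
      have := hbal v
      simp only [outCount_add_single, inCount_add_single, entranceCount] at this ⊢
      split_ifs at this ⊢ <;> omega
    · obtain ⟨o', rfl⟩ : ∃ o' : ι × ι → ℕ, o = o' + Pi.single (x, w) 1 :=
        ⟨_, (sub_single_add_single hw).symm⟩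
      rw [add_tsub_cancel_right]
      refine ih w _ _ (le_trans (le_add_of_nonneg_right (fun _ => Nat.zero_le _)) hom) (by omega)
        fun v => ?_
      have := hbal v
      simp only [outCount_add_single, inCount_add_single, entranceCount] at this ⊢
      split_ifs at this ⊢ <;> omega

/-- Both current positions now enter the balance. Once the first walk is complete, the term of its
endpoint is dropped, as the inequality allows. -/
theorem walkSum_edgeWeight_le {β : ι × ι → ℝ} {K τ B : ℝ} {N : ℕ} (hs : 0 < s) (hδ : 0 < δ)
    (hδ1 : δ ≤ 1) (hβ : ∀ e, 0 ≤ β e) (hK : 1 ≤ K) (hrow : ∀ v, ∑ w, β (v, w) ≤ τ)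
    (hτ : τ ≤ s ^ 2) (hB : ∀ e, β e ≤ B) (r x : ι) (k l : ℕ) :
    ∀ (u : ι) (o m : ι × ι → ℕ), o ≤ m → k + l + ∑ e, m e ≤ N →
      (∀ v, 2 * outCount m v + inCount o v + (if v = x then 1 else 0) +
        (if v = u then 1 else 0) ≤ 2 * entranceCount r m v + outCount o v) →
      walkSum k l u x (edgeWeight β K o m) ≤
        (s + δ * s + 2 * K * B * N / (δ * s)) ^ (k + l) * potential s δ r o m := by
  have hB0 : 0 ≤ B := (hβ (x, x)).trans (hB (x, x))
  induction k with
  | zero =>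
    intro u o m hom hN hbal
    rw [Nat.zero_add]
    exact walkSum_zero_edgeWeight_le hs hδ hδ1 hβ hK hrow hτ hB r u l x o m hom (by omega)
      fun v => by have := hbal v; omega
  | succ k ih =>
    intro u o m hom hN hbal
    rw [walkSum_edgeWeight_succ_left, Nat.succ_add, pow_succ, mul_assoc]
    refine sum_le_of_step (S := fun w o m => walkSum k l w x (edgeWeight β K o m)) hβ hK
      (by positivity) (fun w => ?_) (fun w hw => ?_)
      (sum_step_potential_le hs hδ hδ1 hβ hK hrow hτ hB r u hom (by omega))
    · refine ih w _ _ (add_le_add_left hom _) (by rw [sum_add_single]; omega) fun v => ?_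
      have := hbal v
      simp only [outCount_add_single, inCount_add_single, entranceCount] at this ⊢
      split_ifs at this ⊢ <;> omega
    · obtain ⟨o', rfl⟩ : ∃ o' : ι × ι → ℕ, o = o' + Pi.single (u, w) 1 :=
        ⟨_, (sub_single_add_single hw).symm⟩
      rw [add_tsub_cancel_right]
      refine ih w _ _ (le_trans (le_add_of_nonneg_right (fun _ => Nat.zero_le _)) hom) (by omega)
        fun v => ?_
      have := hbal v
      simp only [outCount_add_single, inCount_add_single, entranceCount] at this ⊢
      split_ifs at this ⊢ <;> omega

/-- The total pairing weight of the pairs of walks of length `p` from `r`. -/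
theorem walkSum_edgeWeight_zero_le {β : ι × ι → ℝ} {K σ b : ℝ} {p : ℕ} (hp : 1 ≤ p)
    (hβ : ∀ e, 0 ≤ β e) (hK : 1 ≤ K) (hσ : 0 ≤ σ) (hrow : ∀ v, ∑ w, β (v, w) ≤ σ ^ 2)
    (hb : 0 < b) (hB : ∀ e, β e ≤ b ^ 2) (r : ι) :
    walkSum p p r r (edgeWeight β K 0 0) ≤ (σ + (2 + 6 * K) * √p * b) ^ (2 * p) := by
  have hp0 : (1 : ℝ) ≤ p := by exact_mod_cast hp
  have hsp : 0 < √(p : ℝ) := Real.sqrt_pos.2 (by linarith)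
  -- The choice δs = √p b makes δs and Kb²p/(δs) comparable; the summand `√p * b` in `s` ensures `δ
  -- ≤ 1`.
  set s := σ + √p * b with hs
  have hs0 : 0 < s := by positivity
  set δ := √p * b / s with hδ
  have hδ0 : 0 < δ := by positivity
  have hδ1 : δ ≤ 1 := by rw [hδ, div_le_one hs0]; linarith
  have h := walkSum_edgeWeight_le (N := 2 * p + 1) hs0 hδ0 hδ1 hβ hK hrow
    (by rw [hs]; gcongr; nlinarith) hB r r p p r 0 0 le_rfl (by simp; omega)
    (by
      intro v
      simp only [outCount, inCount, entranceCount, Pi.zero_apply, Finset.sum_const_zero]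
      split_ifs <;> omega)
  have hV : potential s δ r 0 0 = 1 := by
    simp [potential, exitPotential, entrancePotential, outCount, inCount, entranceCount]
    refine Finset.prod_eq_one fun v _ => ?_
    split_ifs <;> simp
  rw [hV, mul_one, ← two_mul] at h
  refine h.trans (pow_le_pow_left₀ (by positivity) ?_ _)
  have hδs : δ * s = √p * b := by rw [hδ]; field_simp
  rw [hδs]
  have : 2 * K * b ^ 2 * ((2 * p + 1 : ℕ) : ℝ) / (√p * b) ≤ 6 * K * √p * b := by
    rw [div_le_iff₀ (by positivity)]
    have h2 : √(p : ℝ) * √p = p := Real.mul_self_sqrt (by linarith)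
    calc 2 * K * b ^ 2 * ((2 * p + 1 : ℕ) : ℝ) ≤ 2 * K * b ^ 2 * (3 * p) := by
          gcongr; push_cast; linarith
      _ = 6 * K * b ^ 2 * (√p * √p) := by rw [h2]; ring
      _ = _ := by ring
  rw [hs]
  linarith

end WalkBound

/-! ### Moments of one entry -/

/-- Symmetric laws of unit variance with sub-Gaussian moments. -/
structure HasSubGaussianMoments (K : ℝ) (μ : Measure ℂ) : Prop where
  isProbabilityMeasure : IsProbabilityMeasure μ
  unit_variance : ∫ z, ‖z‖ ^ 2 ∂μ = 1
  symmetric : μ.map (fun z => -z) = μ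
  moment_le : ∀ m : ℕ, 1 ≤ m → ∫⁻ z, ‖z‖ₑ ^ (2 * m) ∂μ ≤ ENNReal.ofReal ((K * m) ^ m)

section Law

open ComplexConjugate

variable {K : ℝ} {μ : Measure ℂ}

theorem HasSubGaussianMoments.integrable_norm_pow_even (h : HasSubGaussianMoments K μ) (m : ℕ) :
    Integrable (fun z : ℂ => ‖z‖ ^ (2 * m)) μ := by
  have := h.isProbabilityMeasure
  rcases Nat.eq_zero_or_pos m with rfl | hm
  · simp
  · refine ⟨by fun_prop, ?_⟩
    rw [hasFiniteIntegral_iff_enorm]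
    simp only [enorm_pow, enorm_norm]
    exact (h.moment_le m hm).trans_lt ENNReal.ofReal_lt_top

theorem HasSubGaussianMoments.integrable_norm_pow (h : HasSubGaussianMoments K μ) (k : ℕ) :
    Integrable (fun z : ℂ => ‖z‖ ^ k) μ := by
  have := h.isProbabilityMeasure
  refine ((integrable_const (1 : ℝ)).add (h.integrable_norm_pow_even k)).mono' (by fun_prop) ?_
  refine ae_of_all _ fun z => ?_
  simp only [Pi.add_apply, norm_pow, norm_norm, pow_mul']
  nlinarith [sq_nonneg (‖z‖ ^ k - 1)]

theorem HasSubGaussianMoments.integrable_monomial (h : HasSubGaussianMoments K μ) (a a' : ℕ) :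
    Integrable (fun z : ℂ => z ^ a * conj z ^ a') μ := by
  refine (h.integrable_norm_pow (a + a')).mono' (by fun_prop) (ae_of_all _ fun z => ?_)
  simp [pow_add]

theorem HasSubGaussianMoments.integral_norm_pow_le (h : HasSubGaussianMoments K μ) (hK : 0 ≤ K)
    {m : ℕ} (hm : 1 ≤ m) : ∫ z, ‖z‖ ^ (2 * m) ∂μ ≤ (K * m) ^ m := by
  rw [integral_eq_lintegral_of_nonneg_ae (ae_of_all _ fun z => by positivity) (by fun_prop)]
  refine ENNReal.toReal_le_of_le_ofReal (by positivity) (le_trans (le_of_eq ?_) (h.moment_le m hm))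
  refine lintegral_congr fun z => ?_
  rw [ENNReal.ofReal_pow (norm_nonneg _), ofReal_norm]

/-- Combines m^m ≤ e^m m! with 2^m (m!)² ≤ (2m)!. -/
theorem pow_le_factorial_mul (m : ℕ) :
    (m : ℝ) ^ m ≤ 3 ^ m * ((2 * m).factorial / (2 ^ m * m.factorial)) := by
  have h1 : (m : ℝ) ^ m ≤ 3 ^ m * m.factorial := by
    have h := Real.pow_div_factorial_le_exp (m : ℝ) (Nat.cast_nonneg m) m
    rw [div_le_iff₀ (by positivity)] at h
    refine h.trans ?_
    gcongr
    rw [← Real.exp_one_pow]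
    gcongr
    exact Real.exp_one_lt_d9.le.trans (by norm_num)
  refine h1.trans ?_
  gcongr
  rw [le_div_iff₀ (by positivity)]
  have h2 : m.factorial * (2 ^ m * m.factorial) ≤ (2 * m).factorial := by
    have h3 : m.factorial * 2 ^ m ≤ (2 * m).factorial / m.factorial := by
      rw [Nat.le_div_iff_mul_le (Nat.factorial_pos m)]
      clear h1
      induction m with
      | zero => simp
      | succ m ih =>
        have e : (2 * (m + 1)).factorial = (2 * m + 2) * ((2 * m + 1) * (2 * m).factorial) := by
          rw [show 2 * (m + 1) = 2 * m + 1 + 1 by ring, Nat.factorial_succ, Nat.factorial_succ]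
        rw [e, Nat.factorial_succ, pow_succ]
        calc (m + 1) * m.factorial * (2 ^ m * 2) * ((m + 1) * m.factorial)
            = (2 * m + 2) * ((m + 1) * (m.factorial * 2 ^ m * m.factorial)) := by ring
          _ ≤ (2 * m + 2) * ((2 * m + 1) * (2 * m).factorial) := by gcongr; omega
    calc m.factorial * (2 ^ m * m.factorial) = m.factorial * 2 ^ m * m.factorial := by ring
      _ ≤ (2 * m).factorial / m.factorial * m.factorial := Nat.mul_le_mul_right _ h3
      _ ≤ _ := Nat.div_mul_le_self _ _
  exact_mod_cast h2

/-- The weight of reopened edges for the sub-Gaussian constant `K`. -/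
def reopenConst (K : ℝ) : ℝ := (1 + 3 * K) ^ 2

theorem one_le_reopenConst (hK : 0 ≤ K) : 1 ≤ reopenConst K := by
  unfold reopenConst; nlinarith

/-- Odd total degree vanishes by symmetry. Degree two is exact thanks to unit variance, which keeps
the first opening free of any constant; higher even degrees are compared with the double factorial.
-/
theorem HasSubGaussianMoments.norm_integral_monomial_le (h : HasSubGaussianMoments K μ)
    (hK : 0 ≤ K) (b : ℂ) (a a' : ℕ) :
    ‖∫ z, (b * z) ^ a * conj (b * z) ^ a' ∂μ‖ ≤
      pairWeight (‖b‖ ^ 2) (reopenConst K) (a + a') 0 0 := by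
  have := h.isProbabilityMeasure
  have hb : (0 : ℝ) ≤ ‖b‖ ^ 2 := by positivity
  have hK1 := one_le_reopenConst hK
  have hI : ‖∫ z, (b * z) ^ a * conj (b * z) ^ a' ∂μ‖ ≤
      ‖b‖ ^ (a + a') * ∫ z, ‖z‖ ^ (a + a') ∂μ := by
    refine (norm_integral_le_integral_norm _).trans (le_of_eq ?_)
    rw [← integral_const_mul]
    congr 1 with z
    simp [pow_add, mul_pow]
    ring
  rcases Nat.even_or_odd (a + a') with he | ho
  · obtain ⟨m, hm⟩ := he
    rw [← two_mul] at hm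
    rw [hm] at hI ⊢
    refine hI.trans ?_
    rcases m with _ | _ | m
    · simp [pairWeight]
    · simp [h.unit_variance, pairWeight]
    · refine le_trans ?_ (pow_mul_factorial_div_le_pairWeight hb (by linarith) (m + 1))
      rw [pow_mul, mul_assoc]
      gcongr
      refine (h.integral_norm_pow_le hK (by omega)).trans ?_
      rw [mul_pow]
      have h1 := pow_le_factorial_mul (m + 1 + 1)
      have h0 : (0:ℝ) ≤ K ^ (m + 1 + 1) := by positivity
      refine (mul_le_mul_of_nonneg_left h1 h0).trans ?_
      rw [← mul_assoc, ← mul_pow]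
      gcongr
      unfold reopenConst
      rw [← pow_mul]
      -- Only `m + 1` reopenings are available to absorb `m + 2` factors `3 * K`; hence the square
      -- in `reopenConst`.
      calc (K * 3) ^ (m + 1 + 1) ≤ (1 + 3 * K) ^ (m + 1 + 1) := by gcongr; linarith
        _ ≤ (1 + 3 * K) ^ (2 * (m + 1)) := pow_le_pow_right₀ (by linarith) (by omega)
  · have hz : ∫ z, (b * z) ^ a * conj (b * z) ^ a' ∂μ = 0 := by
      have h1 : ∫ z, (b * z) ^ a * conj (b * z) ^ a' ∂μ =
          ∫ z, (b * -z) ^ a * conj (b * -z) ^ a' ∂μ := by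
        conv_lhs => rw [← h.symmetric]
        rw [integral_map (by fun_prop) (by fun_prop)]
      have h2 : ∀ z : ℂ, (b * -z) ^ a * conj (b * -z) ^ a' =
          -((b * z) ^ a * conj (b * z) ^ a') := by
        intro z
        rw [mul_neg, map_neg, neg_pow, neg_pow (conj (b * z)), mul_mul_mul_comm, ← pow_add,
          ho.neg_one_pow]
        ring
      simp only [h2, integral_neg] at h1
      exact self_eq_neg.1 h1
    rw [hz, norm_zero]
    exact pairWeight_nonneg hb (by linarith) _ _ _

end Law

/-! ### Expansion of matrix powers over walks -/

section Array

open ComplexConjugate Matrix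

variable {ι : Type*} [Fintype ι] [DecidableEq ι] {Ω : Type*} [MeasurableSpace Ω]

/-- Monomials in the matrix entries and in their conjugates. -/
def entryMonomial (M : Matrix ι ι ℂ) (a a' : ι × ι → ℕ) : ℂ :=
  ∏ e : ι × ι, M e.1 e.2 ^ a e * conj (M e.1 e.2) ^ a' e

theorem prod_pow_single (f : ι × ι → ℂ) (e : ι × ι) :
    ∏ x, f x ^ (Pi.single e 1 : ι × ι → ℕ) x = f e := by
  rw [Finset.prod_eq_single e (fun x _ hx => by simp [hx]) (by simp)]
  simp

theorem entryMonomial_mul_entry (M : Matrix ι ι ℂ) (a a' : ι × ι → ℕ) (u w : ι) :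
    entryMonomial M a a' * M u w = entryMonomial M (a + Pi.single (u, w) 1) a' := by
  unfold entryMonomial
  simp only [Pi.add_apply, pow_add, Finset.prod_mul_distrib,
    prod_pow_single fun e : ι × ι => M e.1 e.2]
  ring

theorem entryMonomial_mul_conj_entry (M : Matrix ι ι ℂ) (a a' : ι × ι → ℕ) (u w : ι) :
    entryMonomial M a a' * conj (M u w) = entryMonomial M a (a' + Pi.single (u, w) 1) := by
  unfold entryMonomial
  simp only [Pi.add_apply, pow_add, Finset.prod_mul_distrib,
    prod_pow_single fun e : ι × ι => conj (M e.1 e.2)]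
  ring

/-- If all moments of the entries are bounded by `F`, then the mixed moments of matrix powers are
bounded by sums of `F` over walks. -/
theorem norm_integral_entryMonomial_mul_pow_le {P : Measure Ω} {A : Ω → Matrix ι ι ℂ}
    {F : (ι × ι → ℕ) → ℝ} (hF : ∀ c, 0 ≤ F c)
    (hint : ∀ a a', Integrable (fun ω => entryMonomial (A ω) a a') P)
    (hmom : ∀ a a', ‖∫ ω, entryMonomial (A ω) a a' ∂P‖ ≤ F (a + a')) (k l : ℕ) :
    ∀ (u x : ι) (a a' : ι × ι → ℕ),
      Integrable (fun ω => entryMonomial (A ω) a a' * (A ω ^ k * (A ω ^ l)ᴴ) u x) P ∧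
      ‖∫ ω, entryMonomial (A ω) a a' * (A ω ^ k * (A ω ^ l)ᴴ) u x ∂P‖ ≤
        walkSum k l u x fun c => F (a + a' + c) := by
  induction k with
  | zero =>
    induction l with
    | zero =>
      intro u x a a'
      simp only [pow_zero, conjTranspose_one, mul_one, walkSum, add_zero]
      -- Distinct endpoints contribute zero; `walkSum` keeps them anyway, at the price of a
      -- nonnegative term.
      by_cases hux : u = x
      · subst hux
        simpa using ⟨hint a a', hmom a a'⟩
      · simpa [Matrix.one_apply_ne hux] using hF _
    | succ l ih =>
      intro u x a a'
      have hexp : ∀ ω, entryMonomial (A ω) a a' * (A ω ^ 0 * (A ω ^ (l + 1))ᴴ) u x =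
          ∑ w, entryMonomial (A ω) a (a' + Pi.single (x, w) 1) * (A ω ^ 0 * (A ω ^ l)ᴴ) u w := by
        intro ω
        simp only [pow_zero, one_mul]
        simp only [conjTranspose_apply, pow_succ' (A ω) l, mul_apply, star_sum,
          star_mul', Finset.mul_sum, ← entryMonomial_mul_conj_entry, ← mul_assoc]
        rfl
      simp only [hexp]
      refine ⟨integrable_finsetSum _ fun w _ => (ih u w _ _).1, ?_⟩
      rw [integral_finsetSum _ fun w _ => (ih u w _ _).1]
      refine (norm_sum_le _ _).trans ?_
      rw [walkSum]
      refine Finset.sum_le_sum fun w _ => ((ih u w _ _).2).trans (le_of_eq ?_)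
      congr 1 with c
      congr 1
      abel
  | succ k ih =>
    intro u x a a'
    have hexp : ∀ ω, entryMonomial (A ω) a a' * (A ω ^ (k + 1) * (A ω ^ l)ᴴ) u x =
        ∑ w, entryMonomial (A ω) (a + Pi.single (u, w) 1) a' * (A ω ^ k * (A ω ^ l)ᴴ) w x := by
      intro ω
      rw [pow_succ', Matrix.mul_assoc, mul_apply, Finset.mul_sum]
      simp only [← entryMonomial_mul_entry, mul_assoc]
    simp only [hexp]
    refine ⟨integrable_finsetSum _ fun w _ => (ih w x _ _).1, ?_⟩
    rw [integral_finsetSum _ fun w _ => (ih w x _ _).1]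
    refine (norm_sum_le _ _).trans ?_
    rw [walkSum]
    refine Finset.sum_le_sum fun w _ => ((ih w x _ _).2).trans (le_of_eq ?_)
    congr 1 with c
    congr 1
    abel

omit [DecidableEq ι] in
theorem sum_norm_sq_eq_sum_mul_conjTranspose (M : Matrix ι ι ℂ) (u : ι) :
    (((∑ y, ‖M u y‖ ^ 2 : ℝ)) : ℂ) = (M * Mᴴ) u u := by
  simp only [mul_apply, conjTranspose_apply, Complex.ofReal_sum]
  refine Finset.sum_congr rfl fun y _ => ?_
  rw [← starRingEnd_apply, Complex.mul_conj, Complex.normSq_eq_norm_sq]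

end Array

/-! ### Second moments of the powers of the random matrix -/

section RandomMatrix

open ComplexConjugate Matrix

variable {Ω : Type*} [MeasurableSpace Ω] {P : Measure Ω} {K : ℝ} {μ : Measure ℂ} {n : ℕ}
  {b : Fin n → Fin n → ℂ} {g : Fin n → Fin n → Ω → ℂ}

theorem integrable_entryMonomial (hμ : HasSubGaussianMoments K μ) (hg : IsIIDArray P μ g)
    (a a' : Fin n × Fin n → ℕ) :
    Integrable (fun ω => entryMonomial (randomMatrix b g ω) a a') P := by
  have := hμ.isProbabilityMeasure
  have hm : ∀ p : Fin n × Fin n, AEMeasurable (fun ω => g p.1 p.2 ω) P :=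
    fun p => (hg.hasLaw p.1 p.2).aemeasurable
  have hmap := hg.indep.map_fun_eq_pi_map hm
  have hlaw : ∀ p : Fin n × Fin n, P.map (fun ω => g p.1 p.2 ω) = μ :=
    fun p => (hg.hasLaw p.1 p.2).map_eq
  simp only [hlaw] at hmap
  have h1 : Integrable (fun x : Fin n × Fin n → ℂ => ∏ e : Fin n × Fin n,
      (b e.1 e.2 * x e) ^ a e * conj (b e.1 e.2 * x e) ^ a' e)
      (Measure.pi fun _ : Fin n × Fin n => μ) := by
    refine Integrable.fintype_prod (f := fun (e : Fin n × Fin n) (z : ℂ) =>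
      (b e.1 e.2 * z) ^ a e * conj (b e.1 e.2 * z) ^ a' e) fun e => ?_
    refine ((hμ.integrable_monomial (a e) (a' e)).const_mul
      (b e.1 e.2 ^ a e * conj (b e.1 e.2) ^ a' e)).congr (ae_of_all _ fun z => ?_)
    simp only [mul_pow, map_mul]
    ring
  rw [← hmap] at h1
  exact h1.comp_aemeasurable (by fun_prop)

theorem norm_integral_entryMonomial_le (hK : 0 ≤ K) (hμ : HasSubGaussianMoments K μ)
    (hg : IsIIDArray P μ g) (a a' : Fin n × Fin n → ℕ) :
    ‖∫ ω, entryMonomial (randomMatrix b g ω) a a' ∂P‖ ≤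
      edgeWeight (fun e => ‖b e.1 e.2‖ ^ 2) (reopenConst K) 0 0 (a + a') := by
  have := hμ.isProbabilityMeasure
  have hm : ∀ p : Fin n × Fin n, AEMeasurable (fun ω => g p.1 p.2 ω) P :=
    fun p => (hg.hasLaw p.1 p.2).aemeasurable
  have h1 := hg.indep.integral_fun_prod_comp hm (f := fun (e : Fin n × Fin n) (z : ℂ) =>
      (b e.1 e.2 * z) ^ a e * conj (b e.1 e.2 * z) ^ a' e) (fun e => by fun_prop)
  have h2 : ∫ ω, entryMonomial (randomMatrix b g ω) a a' ∂P =
      ∏ e : Fin n × Fin n, ∫ z, (b e.1 e.2 * z) ^ a e * conj (b e.1 e.2 * z) ^ a' e ∂μ := by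
    refine h1.trans (Finset.prod_congr rfl fun e _ => ?_)
    rw [← (hg.hasLaw e.1 e.2).map_eq, integral_map (hm e) (by fun_prop)]
  rw [h2, norm_prod]
  exact Finset.prod_le_prod (fun _ _ => norm_nonneg _) fun e _ =>
    hμ.norm_integral_monomial_le hK _ _ _

/-- The moment bound for the Hilbert–Schmidt norm of a power of the random matrix. -/
theorem integral_sum_norm_sq_pow_le (hK : 0 ≤ K) (hμ : HasSubGaussianMoments K μ)
    (hg : IsIIDArray P μ g) {σ s : ℝ} (hσ : 0 ≤ σ) (hrow : ∀ v, ∑ w, ‖b v w‖ ^ 2 ≤ σ ^ 2)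
    (hs : 0 < s) (hb : ∀ v w, ‖b v w‖ ≤ s) {p : ℕ} (hp : 1 ≤ p) :
    Integrable (fun ω => ∑ u, ∑ y, ‖(randomMatrix b g ω ^ p) u y‖ ^ 2) P ∧
    ∫ ω, ∑ u, ∑ y, ‖(randomMatrix b g ω ^ p) u y‖ ^ 2 ∂P ≤
      n * (σ + (2 + 6 * reopenConst K) * √p * s) ^ (2 * p) := by
  have hK1 := one_le_reopenConst hK
  set β : Fin n × Fin n → ℝ := fun e => ‖b e.1 e.2‖ ^ 2 with hβ
  have hβ0 : ∀ e, 0 ≤ β e := fun e => by positivity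
  have key := fun u => norm_integral_entryMonomial_mul_pow_le (P := P) (A := randomMatrix b g)
    (F := edgeWeight β (reopenConst K) 0 0)
    (fun c => Finset.prod_nonneg fun e _ => pairWeight_nonneg (hβ0 e) (by linarith) _ _ _)
    (integrable_entryMonomial hμ hg) (norm_integral_entryMonomial_le hK hμ hg) p p u u 0 0
  have hone : ∀ ω, entryMonomial (randomMatrix b g ω) 0 0 = 1 := by
    intro ω; simp [entryMonomial]
  simp only [hone, one_mul, zero_add, ← sum_norm_sq_eq_sum_mul_conjTranspose] at key
  have hint : ∀ u, Integrable (fun ω => ∑ y, ‖(randomMatrix b g ω ^ p) u y‖ ^ 2) P :=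
    fun u => (key u).1.re
  refine ⟨integrable_finsetSum _ fun u _ => hint u, ?_⟩
  rw [integral_finsetSum _ fun u _ => hint u]
  have hterm : ∀ u ∈ (Finset.univ : Finset (Fin n)),
      ∫ ω, ∑ y, ‖(randomMatrix b g ω ^ p) u y‖ ^ 2 ∂P ≤
        (σ + (2 + 6 * reopenConst K) * √p * s) ^ (2 * p) := by
    intro u _
    have h1 := (key u).2
    rw [integral_complex_ofReal, Complex.norm_real] at h1
    refine (le_abs_self _).trans (h1.trans ?_)
    exact walkSum_edgeWeight_zero_le hp hβ0 hK1 hσ hrow hs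
      (fun e => pow_le_pow_left₀ (norm_nonneg _) (hb _ _) 2) u
  refine (Finset.sum_le_sum hterm).trans (le_of_eq ?_)
  simp

/-- The case of the first power without any `σ_*` term, needed when log n is small compared with
log(1+ε). -/
theorem integral_sum_norm_sq_le (hμ : HasSubGaussianMoments K μ)
    (hg : IsIIDArray P μ g) {σ : ℝ} (hrow : ∀ v, ∑ w, ‖b v w‖ ^ 2 ≤ σ ^ 2) :
    Integrable (fun ω => ∑ u, ∑ y, ‖(randomMatrix b g ω) u y‖ ^ 2) P ∧
    ∫ ω, ∑ u, ∑ y, ‖(randomMatrix b g ω) u y‖ ^ 2 ∂P ≤ n * σ ^ 2 := by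
  have hmap := fun u y => (hg.hasLaw u y).map_eq
  have hm := fun u y => (hg.hasLaw u y).aemeasurable
  have hint : ∀ u y, Integrable (fun ω => ‖(randomMatrix b g ω) u y‖ ^ 2) P := by
    intro u y
    have h1 := hμ.integrable_norm_pow 2
    rw [← hmap u y] at h1
    simpa [randomMatrix, mul_pow] using (h1.comp_aemeasurable (hm u y)).const_mul (‖b u y‖ ^ 2)
  have hval : ∀ u y, ∫ ω, ‖(randomMatrix b g ω) u y‖ ^ 2 ∂P = ‖b u y‖ ^ 2 := by
    intro u y
    have h1 := hμ.unit_variance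
    rw [← hmap u y, integral_map (hm u y) (by fun_prop)] at h1
    simp [randomMatrix, mul_pow, integral_const_mul, h1]
  refine ⟨integrable_finsetSum _ fun u _ => integrable_finsetSum _ fun y _ => hint u y, ?_⟩
  rw [integral_finsetSum _ fun u _ => integrable_finsetSum _ fun y _ => hint u y]
  simp only [integral_finsetSum _ fun y _ => hint _ y, hval]
  exact (Finset.sum_le_sum fun u _ => hrow u).trans (le_of_eq (by simp))

end RandomMatrix

/-! ### Gaussian laws have sub-Gaussian moments -/

section Gaussian

/-- One term of the exponential series at `√m * |x|`, the scale at which the Gaussian exponential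
moments stay of order C^m. -/
theorem pow_le_mul_exp_add_exp {m : ℕ} (hm : 1 ≤ m) (x : ℝ) :
    x ^ (2 * m) ≤ (4 * m) ^ m * (Real.exp (√m * x) + Real.exp (-√m * x)) := by
  have hm0 : (0 : ℝ) < m := by exact_mod_cast hm
  have hs : √(m : ℝ) ^ 2 = m := Real.sq_sqrt hm0.le
  have h1 := Real.pow_div_factorial_le_exp (√m * |x|) (by positivity) (2 * m)
  have h2 : Real.exp (√m * |x|) ≤ Real.exp (√m * x) + Real.exp (-√m * x) := by
    rcases abs_cases x with ⟨h, _⟩ | ⟨h, _⟩ <;> rw [h]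
    · linarith [Real.exp_pos (-√m * x)]
    · have : √(m : ℝ) * -x = -√m * x := by ring
      rw [this]; linarith [Real.exp_pos (√m * x)]
  have h3 : ((2 * m).factorial : ℝ) ≤ (2 * m) ^ (2 * m) := by
    exact_mod_cast Nat.factorial_le_pow (2 * m)
  have h4 : (√m * |x|) ^ (2 * m) = m ^ m * x ^ (2 * m) := by
    rw [mul_pow, pow_mul, hs, pow_mul, sq_abs, ← pow_mul]
  rw [div_le_iff₀ (by positivity), h4] at h1
  have h5 : (m : ℝ) ^ m * x ^ (2 * m) ≤
      m ^ m * ((4 * m) ^ m * (Real.exp (√m * x) + Real.exp (-√m * x))) := by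
    calc _ ≤ Real.exp (√m * |x|) * (2 * m).factorial := h1
      _ ≤ (Real.exp (√m * x) + Real.exp (-√m * x)) * (2 * m) ^ (2 * m) := by gcongr
      _ = _ := by rw [pow_mul, show (2 * (m : ℝ)) ^ 2 = m * (4 * m) by ring, mul_pow]; ring
  exact le_of_mul_le_mul_left h5 (by positivity)

theorem lintegral_pow_gaussianReal_le {v : ℝ≥0} (hv : v ≤ 1) {m : ℕ} (hm : 1 ≤ m) :
    ∫⁻ x, ENNReal.ofReal (x ^ (2 * m)) ∂(gaussianReal 0 v) ≤ ENNReal.ofReal ((16 * m) ^ m) := by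
  have hm0 : (0 : ℝ) < m := by exact_mod_cast hm
  have hint : ∀ t : ℝ, Integrable (fun x => Real.exp (t * x)) (gaussianReal 0 v) :=
    fun t => integrable_exp_mul_gaussianReal t
  have hval : ∀ t : ℝ, ∫ x, Real.exp (t * x) ∂(gaussianReal 0 v) = Real.exp (v * t ^ 2 / 2) := by
    intro t
    have := congrFun (mgf_id_gaussianReal (μ := 0) (v := v)) t
    simpa [mgf] using this
  refine (lintegral_mono fun x => ENNReal.ofReal_le_ofReal (pow_le_mul_exp_add_exp hm x)).trans ?_
  have hi : Integrable (fun x => (4 * (m : ℝ)) ^ m *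
      (Real.exp (√m * x) + Real.exp (-√m * x))) (gaussianReal 0 v) :=
    ((hint _).add (hint _)).const_mul _
  rw [← ofReal_integral_eq_lintegral_ofReal hi
    (ae_of_all _ fun x => by positivity)]
  apply ENNReal.ofReal_le_ofReal
  rw [integral_const_mul, integral_add (hint _) (hint _), hval, hval]
  have hs : √(m : ℝ) ^ 2 = m := Real.sq_sqrt hm0.le
  rw [neg_sq, hs]
  have h1 : Real.exp (v * m / 2) ≤ 2 ^ m := by
    have hv' : (v : ℝ) ≤ 1 := by exact_mod_cast hv
    have h2 : Real.exp (1 / 2) ≤ 2 := by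
      have : Real.exp (1 / 2) ^ 2 ≤ 2 ^ 2 := by
        rw [← Real.exp_nat_mul]
        norm_num
        exact Real.exp_one_lt_d9.le.trans (by norm_num)
      exact le_of_sq_le_sq this (by norm_num)
    calc Real.exp (v * m / 2) ≤ Real.exp (m * (1 / 2)) := by
          apply Real.exp_le_exp.2; nlinarith
      _ = Real.exp (1 / 2) ^ m := by rw [Real.exp_nat_mul]
      _ ≤ 2 ^ m := by gcongr
  have h3 : (2 : ℝ) ≤ 2 ^ m := by
    calc (2 : ℝ) = 2 ^ 1 := by norm_num
      _ ≤ 2 ^ m := pow_le_pow_right₀ (by norm_num) hm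
  calc (4 * (m : ℝ)) ^ m * (Real.exp (v * m / 2) + Real.exp (v * m / 2))
      = (4 * (m : ℝ)) ^ m * (2 * Real.exp (v * m / 2)) := by ring
    _ ≤ (4 * (m : ℝ)) ^ m * (2 ^ m * 2 ^ m) := by gcongr
    _ = _ := by rw [← mul_pow, ← mul_pow]; congr 1; ring

theorem integral_sq_gaussianReal (v : ℝ≥0) : ∫ x, x ^ 2 ∂(gaussianReal 0 v) = v := by
  have h := variance_fun_id_gaussianReal (μ := 0) (v := v)
  rw [variance_eq_integral (by fun_prop)] at h
  simpa using h

theorem integrable_sq_gaussianReal (v : ℝ≥0) :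
    Integrable (fun x : ℝ => x ^ 2) (gaussianReal 0 v) :=
  (memLp_id_gaussianReal (μ := 0) (v := v) 2).integrable_sq

theorem map_neg_gaussianReal_zero (v : ℝ≥0) :
    (gaussianReal 0 v).map (fun x => -x) = gaussianReal 0 v := by
  simpa using gaussianReal_map_neg (μ := 0) (v := v)

theorem hasSubGaussianMoments_stdRealGaussian : HasSubGaussianMoments 64 stdRealGaussian where
  isProbabilityMeasure := Measure.isProbabilityMeasure_map (by fun_prop)
  unit_variance := by
    rw [stdRealGaussian, integral_map (by fun_prop) (by fun_prop)]
    simpa using integral_sq_gaussianReal 1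
  symmetric := by
    rw [stdRealGaussian, Measure.map_map (by fun_prop) (by fun_prop)]
    conv_rhs => rw [← map_neg_gaussianReal_zero, Measure.map_map (by fun_prop) (by fun_prop)]
    congr 1 with x
    simp
  moment_le m hm := by
    rw [stdRealGaussian, lintegral_map (by fun_prop) (by fun_prop)]
    have h : ∀ x : ℝ, ‖(x : ℂ)‖ₑ ^ (2 * m) = ENNReal.ofReal (x ^ (2 * m)) := by
      intro x
      rw [← ofReal_norm, ← ENNReal.ofReal_pow (norm_nonneg _), Complex.norm_real, Real.norm_eq_abs,
        (even_two_mul m).pow_abs]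
    simp only [h]
    refine (lintegral_pow_gaussianReal_le le_rfl hm).trans (ENNReal.ofReal_le_ofReal ?_)
    gcongr
    norm_num

theorem hasSubGaussianMoments_stdComplexGaussian :
    HasSubGaussianMoments 64 stdComplexGaussian where
  isProbabilityMeasure := Measure.isProbabilityMeasure_map (by fun_prop)
  unit_variance := by
    rw [stdComplexGaussian, integral_map (by fun_prop) (by fun_prop)]
    have h : ∀ p : ℝ × ℝ, ‖(p.1 : ℂ) + p.2 * Complex.I‖ ^ 2 = p.1 ^ 2 + p.2 ^ 2 := by
      intro p
      rw [Complex.sq_norm, Complex.normSq_add_mul_I]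
    simp only [h]
    have hi := integrable_sq_gaussianReal (1 / 2)
    rw [integral_add (hi.comp_fst _) (hi.comp_snd _),
      integral_fun_fst (fun x : ℝ => x ^ 2), integral_fun_snd (fun x : ℝ => x ^ 2)]
    simp only [probReal_univ, one_smul, integral_sq_gaussianReal]
    norm_num
  symmetric := by
    have hneg : ((gaussianReal 0 (1 / 2)).prod (gaussianReal 0 (1 / 2))).map
        (Prod.map (fun x : ℝ => -x) (fun x : ℝ => -x)) =
          (gaussianReal 0 (1 / 2)).prod (gaussianReal 0 (1 / 2)) := by
      rw [← Measure.map_prod_map _ _ (by fun_prop) (by fun_prop), map_neg_gaussianReal_zero]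
    rw [stdComplexGaussian, Measure.map_map (by fun_prop) (by fun_prop)]
    conv_rhs => rw [← hneg, Measure.map_map (by fun_prop) (by fun_prop)]
    congr 1 with x
    simp
    ring
  moment_le m hm := by
    rw [stdComplexGaussian, lintegral_map (by fun_prop) (by fun_prop)]
    have h : ∀ p : ℝ × ℝ, ‖(p.1 : ℂ) + p.2 * Complex.I‖ₑ ^ (2 * m) ≤
        ENNReal.ofReal (2 ^ m) * (ENNReal.ofReal (p.1 ^ (2 * m)) +
          ENNReal.ofReal (p.2 ^ (2 * m))) := by
      intro p
      have h1 : 0 ≤ p.1 ^ (2 * m) := (even_two_mul m).pow_nonneg _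
      have h2 : 0 ≤ p.2 ^ (2 * m) := (even_two_mul m).pow_nonneg _
      rw [← ofReal_norm, ← ENNReal.ofReal_pow (norm_nonneg _), ← ENNReal.ofReal_add h1 h2,
        ← ENNReal.ofReal_mul (by positivity)]
      apply ENNReal.ofReal_le_ofReal
      rw [pow_mul, Complex.sq_norm, Complex.normSq_add_mul_I]
      rcases le_total (p.1 ^ 2) (p.2 ^ 2) with hle | hle
      · calc (p.1 ^ 2 + p.2 ^ 2) ^ m ≤ (2 * p.2 ^ 2) ^ m := by gcongr; linarith
          _ = 2 ^ m * p.2 ^ (2 * m) := by rw [mul_pow, ← pow_mul]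
          _ ≤ _ := by gcongr; linarith
      · calc (p.1 ^ 2 + p.2 ^ 2) ^ m ≤ (2 * p.1 ^ 2) ^ m := by gcongr; linarith
          _ = 2 ^ m * p.1 ^ (2 * m) := by rw [mul_pow, ← pow_mul]
          _ ≤ _ := by gcongr; linarith
    refine (lintegral_mono h).trans ?_
    rw [lintegral_const_mul _ (by fun_prop), lintegral_add_left (by fun_prop)]
    have hhalf : (1 / 2 : ℝ≥0) ≤ 1 := by
      rw [← NNReal.coe_le_coe]; norm_num
    have hg := lintegral_pow_gaussianReal_le hhalf hm
    have e1 : ∫⁻ p : ℝ × ℝ, ENNReal.ofReal (p.1 ^ (2 * m))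
        ∂((gaussianReal 0 (1 / 2)).prod (gaussianReal 0 (1 / 2))) =
          ∫⁻ x, ENNReal.ofReal (x ^ (2 * m)) ∂(gaussianReal 0 (1 / 2)) := by
      rw [lintegral_prod _ (by fun_prop)]; simp
    have e2 : ∫⁻ p : ℝ × ℝ, ENNReal.ofReal (p.2 ^ (2 * m))
        ∂((gaussianReal 0 (1 / 2)).prod (gaussianReal 0 (1 / 2))) =
          ∫⁻ x, ENNReal.ofReal (x ^ (2 * m)) ∂(gaussianReal 0 (1 / 2)) := by
      rw [lintegral_prod _ (by fun_prop)]; simp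
    rw [e1, e2]
    refine (mul_le_mul_right (add_le_add hg hg) _).trans ?_
    rw [← ENNReal.ofReal_add (by positivity) (by positivity), ← ENNReal.ofReal_mul (by positivity)]
    apply ENNReal.ofReal_le_ofReal
    have h3 : (2 : ℝ) ≤ 2 ^ m := by
      calc (2 : ℝ) = 2 ^ 1 := by norm_num
        _ ≤ 2 ^ m := pow_le_pow_right₀ (by norm_num) hm
    calc (2 : ℝ) ^ m * ((16 * m) ^ m + (16 * m) ^ m) = 2 ^ m * (2 * (16 * (m : ℝ)) ^ m) := by ring
      _ ≤ 2 ^ m * (2 ^ m * (16 * (m : ℝ)) ^ m) := by gcongr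
      _ = (64 * m) ^ m := by rw [← mul_pow, ← mul_pow]; congr 1; ring

end Gaussian

/-! ### From the Frobenius norm to the spectral radius -/

section SpectralRadius

open Matrix

attribute [local instance] Matrix.frobeniusNormedRing Matrix.frobeniusNormedAlgebra

/-- The Frobenius norm is submultiplicative, but the identity has squared norm `n`; this is the
origin of the factor `n`. -/
theorem spectralRadius_pow_le_ofReal {n : ℕ} (M : Matrix (Fin n) (Fin n) ℂ) {p : ℕ}
    (hp : 1 ≤ p) :
    spectralRadius ℂ M ^ (2 * p) ≤ ENNReal.ofReal (n * ∑ u, ∑ y, ‖(M ^ p) u y‖ ^ 2) := by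
  have hsq : ∀ B : Matrix (Fin n) (Fin n) ℂ, ‖B‖ ^ 2 = ∑ u, ∑ y, ‖B u y‖ ^ 2 := by
    intro B
    rw [frobenius_norm_def, ← Real.rpow_natCast, ← Real.rpow_mul (by positivity)]
    norm_num
  have hone : ‖(1 : Matrix (Fin n) (Fin n) ℂ)‖ ^ 2 = n := by
    rw [hsq]
    simp [Matrix.one_apply, apply_ite norm, ite_pow]
  have hrad : spectralRadius ℂ (M ^ p) ≤ ENNReal.ofReal (‖M ^ p‖ * ‖(1 : Matrix (Fin n) (Fin n) ℂ)‖) := by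
    refine iSup₂_le fun k hk => ?_
    rw [← enorm_eq_nnnorm, ← ofReal_norm]
    exact ENNReal.ofReal_le_ofReal (spectrum.norm_le_norm_mul_of_mem hk)
  calc spectralRadius ℂ M ^ (2 * p) = (spectralRadius ℂ M ^ p) ^ 2 := by rw [← pow_mul']
    _ ≤ (ENNReal.ofReal (‖M ^ p‖ * ‖(1 : Matrix (Fin n) (Fin n) ℂ)‖)) ^ 2 := by
        gcongr
        exact (spectrum.spectralRadius_pow_le M p (by omega)).trans hrad
    _ = _ := by
        rw [← ENNReal.ofReal_pow (by positivity), mul_pow, hone, hsq, mul_comm]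

end SpectralRadius

/-- Jensen's inequality through the tangent line of x^N at `T`, that is, Bernoulli's inequality.
This form requires no measurability of `X`. -/
theorem lintegral_le_of_lintegral_pow_le {Ω : Type*} [MeasurableSpace Ω] {P : Measure Ω}
    [IsProbabilityMeasure P] {X : Ω → ℝ≥0∞} {N : ℕ} (hN : 1 ≤ N) {T : ℝ} (hT : 0 < T)
    (h : ∫⁻ ω, X ω ^ N ∂P ≤ ENNReal.ofReal (T ^ N)) : ∫⁻ ω, X ω ∂P ≤ ENNReal.ofReal T := by
  have hN0 : (1 : ℝ) ≤ N := by exact_mod_cast hN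
  have hc : 0 < T / (N * T ^ N) := by positivity
  have hd : 0 ≤ T * (1 - 1 / N) := by
    have : (1 : ℝ) / N ≤ 1 := by rw [div_le_one (by linarith)]; exact hN0
    exact mul_nonneg hT.le (by linarith)
  have hpt : ∀ x : ℝ≥0∞, x ≤ ENNReal.ofReal (T * (1 - 1 / N)) +
      x ^ N * ENNReal.ofReal (T / (N * T ^ N)) := by
    intro x
    rcases eq_or_ne x ⊤ with rfl | hx
    · rw [ENNReal.top_pow (by omega), ENNReal.top_mul (by simpa using hc)]
      simp
    · obtain ⟨y, hy, rfl⟩ : ∃ y : ℝ, 0 ≤ y ∧ x = ENNReal.ofReal y :=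
        ⟨x.toReal, ENNReal.toReal_nonneg, (ENNReal.ofReal_toReal hx).symm⟩
      rw [← ENNReal.ofReal_pow hy, ← ENNReal.ofReal_mul (by positivity),
        ← ENNReal.ofReal_add hd (by positivity)]
      apply ENNReal.ofReal_le_ofReal
      have hb := one_add_mul_sub_le_pow (a := y / T) (by
        have : 0 ≤ y / T := by positivity
        linarith) N
      rw [div_pow] at hb
      have h2 : y ^ N * (T / (N * T ^ N)) = T / N * (y ^ N / T ^ N) := by field_simp
      rw [h2]
      calc y = T * (1 - 1 / N) + T / N * (1 + N * (y / T - 1)) := by field_simp; ring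
        _ ≤ _ := by gcongr
  refine (lintegral_mono fun ω => hpt (X ω)).trans ?_
  rw [lintegral_add_left measurable_const, lintegral_mul_const' _ _ ENNReal.ofReal_ne_top]
  simp only [lintegral_const, measure_univ, mul_one]
  refine (add_le_add_right (mul_le_mul_left h _) _).trans ?_
  rw [← ENNReal.ofReal_mul (by positivity), ← ENNReal.ofReal_add hd (by positivity)]
  apply ENNReal.ofReal_le_ofReal
  apply le_of_eq
  field_simp
  ring

/-! ### Elementary bounds for `σ` and `σ_*` -/

section Sigma

variable {n : ℕ} (b : Fin n → Fin n → ℂ)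

theorem norm_le_sigmaStar (i j : Fin n) : ‖b i j‖ ≤ sigmaStar b :=
  (le_ciSup (f := fun j => ‖b i j‖) (Set.finite_range _).bddAbove j).trans
    (le_ciSup (f := fun i => ⨆ j, ‖b i j‖) (Set.finite_range _).bddAbove i)

theorem sigmaStar_nonneg : 0 ≤ sigmaStar b :=
  Real.iSup_nonneg fun _ => Real.iSup_nonneg fun _ => norm_nonneg _

theorem sqrt_row_le_sigma (i : Fin n) : √(∑ j, ‖b i j‖ ^ 2) ≤ sigma b :=
  (le_ciSup (f := fun i => √(∑ j, ‖b i j‖ ^ 2)) (Set.finite_range _).bddAbove i).trans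
    (le_max_left _ _)

theorem sigma_nonneg : 0 ≤ sigma b :=
  (Real.iSup_nonneg fun _ => Real.sqrt_nonneg _).trans (le_max_left _ _)

theorem row_le_sigma_sq (i : Fin n) : ∑ j, ‖b i j‖ ^ 2 ≤ sigma b ^ 2 :=
  (Real.sqrt_le_left (sigma_nonneg b)).1 (sqrt_row_le_sigma b i)

theorem norm_le_sigma (i j : Fin n) : ‖b i j‖ ≤ sigma b := by
  refine le_trans ?_ (sqrt_row_le_sigma b i)
  apply Real.le_sqrt_of_sq_le
  exact Finset.single_le_sum (f := fun j => ‖b i j‖ ^ 2) (fun _ _ => by positivity)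
    (Finset.mem_univ j)

end Sigma

/-- Every law in one of the two cases of the theorem has sub-Gaussian moments. -/
theorem exists_hasSubGaussianMoments {𝓛 : Set (Measure ℂ)}
    (h𝓛 : 𝓛 = gaussianLaws ∨ ∃ K : ℝ, 0 < K ∧ 𝓛 = subGaussianLaws K) :
    ∃ K : ℝ, 0 < K ∧ ∀ μ ∈ 𝓛, HasSubGaussianMoments K μ := by
  rcases h𝓛 with rfl | ⟨K, hK, rfl⟩
  · refine ⟨64, by norm_num, fun μ hμ => ?_⟩
    rcases hμ with rfl | rfl
    · exact hasSubGaussianMoments_stdRealGaussian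
    · exact hasSubGaussianMoments_stdComplexGaussian
  · exact ⟨K, hK, fun μ hμ => ⟨hμ.isProbabilityMeasure, hμ.unit_variance, hμ.symmetric,
      hμ.moment_le⟩⟩

/-! ### Bounds on the mean and on the tail -/

/-- The factor of `σ_*` in the moment bounds. -/
def momentConst (K : ℝ) : ℝ := 2 + 6 * reopenConst K

section

variable {Ω : Type*} [MeasurableSpace Ω] {P : Measure Ω} {K : ℝ} {μ : Measure ℂ} {n : ℕ}
  {b : Fin n → Fin n → ℂ} {g : Fin n → Fin n → Ω → ℂ}

theorem momentConst_pos (hK : 0 ≤ K) : 0 < momentConst K := by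
  have := one_le_reopenConst hK
  unfold momentConst; linarith

theorem lintegral_ofReal_mul_le {f : Ω → ℝ} {B c : ℝ} (hc : 0 ≤ c) (hf : ∀ ω, 0 ≤ f ω)
    (h : Integrable f P ∧ ∫ ω, f ω ∂P ≤ B) :
    ∫⁻ ω, ENNReal.ofReal (c * f ω) ∂P ≤ ENNReal.ofReal (c * B) := by
  rw [← ofReal_integral_eq_lintegral_ofReal (h.1.const_mul c)
    (ae_of_all _ fun ω => mul_nonneg hc (hf ω)), integral_const_mul]
  exact ENNReal.ofReal_le_ofReal (mul_le_mul_of_nonneg_left h.2 hc)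

theorem lintegral_spectralRadius_pow_le (hK : 0 ≤ K) (hμ : HasSubGaussianMoments K μ)
    (hg : IsIIDArray P μ g) {s : ℝ} (hs : 0 < s) (hb : ∀ v w, ‖b v w‖ ≤ s) {p : ℕ} (hp : 1 ≤ p) :
    ∫⁻ ω, spectralRadius ℂ (randomMatrix b g ω) ^ (2 * p) ∂P ≤
      ENNReal.ofReal (n * (n * (sigma b + momentConst K * √p * s) ^ (2 * p))) :=
  (lintegral_mono fun ω => spectralRadius_pow_le_ofReal (randomMatrix b g ω) hp).trans
    (lintegral_ofReal_mul_le (Nat.cast_nonneg n) (fun ω => by positivity)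
      (integral_sum_norm_sq_pow_le hK hμ hg (sigma_nonneg b) (row_le_sigma_sq b) hs hb hp))

theorem lintegral_spectralRadius_sq_le (hμ : HasSubGaussianMoments K μ) (hg : IsIIDArray P μ g) :
    ∫⁻ ω, spectralRadius ℂ (randomMatrix b g ω) ^ 2 ∂P ≤
      ENNReal.ofReal (n * (n * sigma b ^ 2)) := by
  refine (lintegral_mono fun ω =>
    spectralRadius_pow_le_ofReal (randomMatrix b g ω) (p := 1) le_rfl).trans ?_
  simp only [pow_one]
  exact lintegral_ofReal_mul_le (Nat.cast_nonneg n) (fun ω => by positivity)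
      (integral_sum_norm_sq_le hμ hg (row_le_sigma_sq b))

theorem lintegral_spectralRadius_le_of_log_lt [IsProbabilityMeasure P]
    (hμ : HasSubGaussianMoments K μ) (hg : IsIIDArray P μ g) (hσ : 0 < sigma b) (hn : 1 ≤ n)
    {ε : ℝ} (hε : 0 < ε) (hL : Real.log n ≤ Real.log (1 + ε)) :
    ∫⁻ ω, spectralRadius ℂ (randomMatrix b g ω) ∂P ≤ ENNReal.ofReal ((1 + ε) * sigma b) := by
  have hn0 : (0 : ℝ) < n := by exact_mod_cast hn
  refine lintegral_le_of_lintegral_pow_le (N := 2) (by norm_num) (by positivity)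
    ((lintegral_spectralRadius_sq_le hμ hg).trans (ENNReal.ofReal_le_ofReal ?_))
  have h1 : (n : ℝ) ≤ 1 + ε := (Real.log_le_log_iff hn0 (by linarith)).1 hL
  calc (n : ℝ) * (n * sigma b ^ 2) = (n * sigma b) ^ 2 := by ring
    _ ≤ _ := by gcongr

theorem lintegral_spectralRadius_le_of_le_log [IsProbabilityMeasure P] (hK : 0 ≤ K)
    (hμ : HasSubGaussianMoments K μ) (hg : IsIIDArray P μ g) (hs : 0 < sigmaStar b) (hn : 1 ≤ n)
    {ε : ℝ} (hε : 0 < ε) (hL : Real.log (1 + ε) ≤ Real.log n) :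
    ∫⁻ ω, spectralRadius ℂ (randomMatrix b g ω) ∂P ≤ ENNReal.ofReal ((1 + ε) *
      (sigma b + momentConst K * √(2 * (Real.log n / Real.log (1 + ε))) * sigmaStar b)) := by
  have hn0 : (0 : ℝ) < n := by exact_mod_cast hn
  have hC := momentConst_pos hK
  have ha : 0 < Real.log (1 + ε) := Real.log_pos (by linarith)
  set L := Real.log n / Real.log (1 + ε) with hLdef
  have hL1 : 1 ≤ L := by rw [hLdef, le_div_iff₀ ha]; linarith
  -- Smallest integer with n ≤ (1+ε)^p, so that n² costs one factor 1 + ε after the root; `1 ≤ L`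
  -- gives `p ≤ 2 * L`.
  set p := ⌈L⌉₊ with hpdef
  have hp : 1 ≤ p := Nat.one_le_ceil_iff.2 (by linarith)
  have hLp : L ≤ p := Nat.le_ceil L
  have hpL : (p : ℝ) ≤ 2 * L := by
    have := Nat.ceil_lt_add_one (show 0 ≤ L by linarith)
    linarith
  have hσ := sigma_nonneg b
  refine lintegral_le_of_lintegral_pow_le (N := 2 * p) (by omega) (by positivity)
    ((lintegral_spectralRadius_pow_le hK hμ hg hs (norm_le_sigmaStar b) hp).trans
      (ENNReal.ofReal_le_ofReal ?_))
  have hnp : (n : ℝ) ≤ (1 + ε) ^ p := by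
    rw [← Real.log_le_log_iff hn0 (by positivity), Real.log_pow]
    rw [hLdef, div_le_iff₀ ha] at hLp
    exact hLp
  calc (n : ℝ) * (n * (sigma b + momentConst K * √p * sigmaStar b) ^ (2 * p))
      ≤ (1 + ε) ^ p * ((1 + ε) ^ p * (sigma b + momentConst K * √p * sigmaStar b) ^ (2 * p)) := by
        gcongr
    _ = ((1 + ε) * (sigma b + momentConst K * √p * sigmaStar b)) ^ (2 * p) := by
        rw [mul_pow, two_mul, pow_add, pow_add]; ring
    _ ≤ _ := by gcongr

/-- With D the square root in the last denominator, sD ≤ σ + 6s√L, so the correction factor already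
supplies the term C√(6L)s. -/
theorem expectation_bound_le {σ s C a l : ℝ} (hσ : 0 < σ) (hs : 0 < s) (hC : 0 ≤ C) (ha : 0 < a)
    (hl : 0 ≤ l) :
    σ + C * √(6 * (l / a)) * s ≤
      (σ + 6 * s / √a * √l) * (1 + C * (√(6 * (l / a)) / √((σ / s) ^ 2 + 6 * (l / a)))) := by
  set L := l / a with hL
  have hL0 : 0 ≤ L := by positivity
  have h1 : 6 * s / √a * √l = 6 * s * √L := by
    rw [hL, Real.sqrt_div hl]; ring
  rw [h1]
  set D := √((σ / s) ^ 2 + 6 * L) with hD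
  have hD0 : 0 < D := Real.sqrt_pos.2 (by positivity)
  have hDX : s * D ≤ σ + 6 * s * √L := by
    refine le_of_sq_le_sq ?_ (by positivity)
    rw [mul_pow, hD, Real.sq_sqrt (by positivity)]
    have h2 : √L ^ 2 = L := Real.sq_sqrt hL0
    have h3 : s ^ 2 * ((σ / s) ^ 2 + 6 * L) = σ ^ 2 + 6 * s ^ 2 * L := by field_simp
    rw [h3]
    have h4 : 0 ≤ σ * s * √L := by positivity
    have h5 : 0 ≤ s ^ 2 * L := by positivity
    calc σ ^ 2 + 6 * s ^ 2 * L ≤ σ ^ 2 + 12 * (σ * s * √L) + 36 * s ^ 2 * L := by linarith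
      _ = σ ^ 2 + 12 * (σ * s * √L) + 36 * s ^ 2 * √L ^ 2 := by rw [h2]
      _ = _ := by ring
  have h6 : 0 ≤ 6 * s * √L := by positivity
  calc σ + C * √(6 * L) * s = σ + (s * D) * (C * (√(6 * L) / D)) := by field_simp
    _ ≤ (σ + 6 * s * √L) + (σ + 6 * s * √L) * (C * (√(6 * L) / D)) := by
        gcongr
        linarith
    _ = _ := by ring

theorem lintegral_spectralRadius_le [IsProbabilityMeasure P] (hK : 0 ≤ K)
    (hμ : HasSubGaussianMoments K μ) (hg : IsIIDArray P μ g) (hn : 1 ≤ n)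
    {ε : ℝ} (hε : 0 < ε) :
    ∫⁻ ω, spectralRadius ℂ (randomMatrix b g ω) ∂P ≤
      ENNReal.ofReal
        ((1 + ε) *
          (sigma b + 6 * sigmaStar b / √(Real.log (1 + ε)) * √(Real.log n)) *
          (1 + momentConst K *
            (√(6 * (Real.log n / Real.log (1 + ε))) /
              √((sigma b / sigmaStar b) ^ 2 + 6 * (Real.log n / Real.log (1 + ε)))))) := by
  have hC := momentConst_pos hK
  have ha : 0 < Real.log (1 + ε) := Real.log_pos (by linarith)
  have hl : 0 ≤ Real.log n := Real.log_natCast_nonneg n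
  rcases (sigmaStar_nonneg b).eq_or_lt with h0 | hs
  · have hb : ∀ i j, b i j = 0 := fun i j =>
      norm_le_zero_iff.1 ((norm_le_sigmaStar b i j).trans h0.ge)
    have hA : ∀ ω, randomMatrix b g ω = 0 := by
      intro ω; ext i j; simp [randomMatrix, hb]
    simp [hA]
  have hσ : 0 < sigma b := by
    by_contra hcon
    have : sigmaStar b ≤ 0 := Real.iSup_le (fun i => Real.iSup_le (fun j =>
      (norm_le_sigma b i j).trans (not_lt.1 hcon)) le_rfl) le_rfl
    linarith
  have hbound := expectation_bound_le hσ hs hC.le ha hl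
  rw [mul_assoc]
  rcases le_total (Real.log n) (Real.log (1 + ε)) with hL | hL
  · refine (lintegral_spectralRadius_le_of_log_lt hμ hg hσ hn hε hL).trans
      (ENNReal.ofReal_le_ofReal ?_)
    gcongr
    refine le_trans ?_ hbound
    have : 0 ≤ momentConst K * √(6 * (Real.log n / Real.log (1 + ε))) * sigmaStar b := by positivity
    linarith
  · refine (lintegral_spectralRadius_le_of_le_log hK hμ hg hs hn hε hL).trans
      (ENNReal.ofReal_le_ofReal ?_)
    gcongr
    refine le_trans ?_ hbound
    gcongr
    norm_num

/-- Markov's inequality is applied to the Frobenius majorant, whose measurability is known. -/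
theorem measure_lt_spectralRadius_le (hK : 0 ≤ K) (hμ : HasSubGaussianMoments K μ)
    (hg : IsIIDArray P μ g) {s R T : ℝ} (hs : 0 < s) (hb : ∀ v w, ‖b v w‖ ≤ s) {p : ℕ}
    (hp : 1 ≤ p) (hR : sigma b + momentConst K * √p * s ≤ R) (hT : 0 < T) :
    P {ω | ENNReal.ofReal T < spectralRadius ℂ (randomMatrix b g ω)} ≤
      ENNReal.ofReal (n ^ 2 * (R / T) ^ (2 * p)) := by
  have hσ := sigma_nonneg b
  have hC := momentConst_pos hK
  have hR0 : 0 ≤ R := le_trans (by positivity) hR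
  obtain ⟨hint, hle⟩ :=
    integral_sum_norm_sq_pow_le hK hμ hg (sigma_nonneg b) (row_le_sigma_sq b) hs hb hp
  set f : Ω → ℝ := fun ω => ∑ u, ∑ y, ‖(randomMatrix b g ω ^ p) u y‖ ^ 2 with hf
  have hsub : {ω | ENNReal.ofReal T < spectralRadius ℂ (randomMatrix b g ω)} ⊆
      {ω | ENNReal.ofReal (T ^ (2 * p)) ≤ ENNReal.ofReal (n * f ω)} := by
    intro ω hω
    rw [Set.mem_ofPred_eq] at hω ⊢
    refine le_trans ?_ (spectralRadius_pow_le_ofReal (randomMatrix b g ω) hp)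
    rw [ENNReal.ofReal_pow hT.le]
    gcongr
  refine (measure_mono hsub).trans ((meas_ge_le_lintegral_div
    (hint.const_mul (n : ℝ)).aemeasurable.ennreal_ofReal (by simpa using by positivity)
      ENNReal.ofReal_ne_top).trans ?_)
  have h1 := lintegral_ofReal_mul_le (Nat.cast_nonneg n) (fun ω => by positivity) ⟨hint, hle⟩
  refine (ENNReal.div_le_div_right h1 _).trans ?_
  rw [← ENNReal.ofReal_div_of_pos (by positivity)]
  apply ENNReal.ofReal_le_ofReal
  rw [div_pow, ← mul_div_assoc]
  refine div_le_div_of_nonneg_right ?_ (by positivity)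
  calc (n : ℝ) * (n * (sigma b + (2 + 6 * reopenConst K) * √p * s) ^ (2 * p))
      = n ^ 2 * (sigma b + momentConst K * √p * s) ^ (2 * p) := by unfold momentConst; ring
    _ ≤ _ := by gcongr

end

/-! ### Almost sure statement -/

theorem ae_eventually_spectralRadius_le {Ω : Type*} [MeasurableSpace Ω] {P : Measure Ω} {K : ℝ}
    (hK : 0 ≤ K) {μ : ℕ → Measure ℂ} (hμ : ∀ n, HasSubGaussianMoments K (μ n))
    {b : (n : ℕ) → Fin n → Fin n → ℂ} {g : (n : ℕ) → Fin n → Fin n → Ω → ℂ}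
    (hg : ∀ n, IsIIDArray P (μ n) (g n))
    (ho : (fun n : ℕ => sigmaStar (b n)) =o[atTop] (fun n : ℕ => 1 / √(Real.log n)))
    {x η : ℝ} (hx : 0 ≤ x) (hη : 0 < η) (hσ : ∀ᶠ n in atTop, sigma (b n) ≤ x + η) :
    ∀ᵐ ω ∂P, ∀ᶠ n in atTop,
      spectralRadius ℂ (randomMatrix (b n) (g n) ω) ≤ ENNReal.ofReal (x + 3 * η) := by
  have hC := momentConst_pos hK
  set q := (x + 2 * η) / (x + 3 * η) with hq
  have hq0 : 0 < q := by positivity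
  have hq1 : q < 1 := by rw [hq, div_lt_one (by positivity)]; linarith
  have hlq : Real.log q < 0 := Real.log_neg hq0 hq1
  -- With p ≥ c log n, q^(2p) ≤ n^(-4), which beats the n² of the tail bound and leaves a summable
  -- n^(-2).
  set c := 2 / -Real.log q with hc
  have hc0 : 0 < c := div_pos two_pos (by linarith)
  set δ := η / (momentConst K * √(c + 2)) with hδ
  have hδ0 : 0 < δ := by positivity
  have hlarge : ∀ᶠ n : ℕ in atTop,
      P {ω | ENNReal.ofReal (x + 3 * η) < spectralRadius ℂ (randomMatrix (b n) (g n) ω)} ≤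
        ENNReal.ofReal (1 / (n : ℝ) ^ 2) := by
    filter_upwards [hσ, ho.def hδ0, eventually_ge_atTop 3] with n hσn hon hn
    have hn3 : (3 : ℝ) ≤ n := by exact_mod_cast hn
    have hlog : 1 ≤ Real.log n := by
      rw [Real.le_log_iff_exp_le (by linarith)]
      exact Real.exp_one_lt_d9.le.trans (by linarith)
    have hsl : 0 < √(Real.log n) := Real.sqrt_pos.2 (by linarith)
    set p := ⌈c * Real.log n⌉₊ + 1 with hp
    have hp1 : c * Real.log n ≤ p := by
      rw [hp]; push_cast; linarith [Nat.le_ceil (c * Real.log n)]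
    have hp2 : (p : ℝ) ≤ (c + 2) * Real.log n := by
      have := Nat.ceil_lt_add_one (show 0 ≤ c * Real.log n by positivity)
      rw [hp]; push_cast; linarith
    -- This positive upper bound replaces `σ_*`, which may vanish; `δ` is chosen so that the moment
    -- correction is at most `η`.
    have hs : ∀ v w, ‖b n v w‖ ≤ δ * (1 / √(Real.log n)) := by
      intro v w
      refine (norm_le_sigmaStar (b n) v w).trans ((le_abs_self _).trans (hon.trans (le_of_eq ?_)))
      rw [Real.norm_of_nonneg (by positivity)]
    have hR : sigma (b n) + momentConst K * √p * (δ * (1 / √(Real.log n))) ≤ x + 2 * η := by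
      have h1 : √(p : ℝ) ≤ √(c + 2) * √(Real.log n) := by
        rw [← Real.sqrt_mul (by positivity)]; exact Real.sqrt_le_sqrt hp2
      have h2 : momentConst K * √p * (δ * (1 / √(Real.log n))) ≤ η := by
        calc _ ≤ momentConst K * (√(c + 2) * √(Real.log n)) * (δ * (1 / √(Real.log n))) := by
              gcongr
          _ = η := by rw [hδ]; field_simp
      linarith
    refine (measure_lt_spectralRadius_le hK (hμ n) (hg n) (by positivity) hs (by omega) hR
      (by positivity)).trans (ENNReal.ofReal_le_ofReal ?_)
    rw [← hq]
    have hn0 : (0 : ℝ) < n := by linarith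
    have h4 : q ^ (2 * p) ≤ 1 / (n : ℝ) ^ 4 := by
      rw [← Real.log_le_log_iff (by positivity) (by positivity), Real.log_pow, one_div,
        Real.log_inv, Real.log_pow]
      push_cast
      have h5 : c * Real.log q = -2 := by
        rw [hc, div_neg, neg_mul, div_mul_cancel₀ _ hlq.ne]
      have h6 : (p : ℝ) * Real.log q ≤ c * Real.log n * Real.log q :=
        mul_le_mul_of_nonpos_right hp1 hlq.le
      have h7 : c * Real.log n * Real.log q = -2 * Real.log n := by
        rw [mul_right_comm, h5]
      linarith
    calc (n : ℝ) ^ 2 * q ^ (2 * p) ≤ n ^ 2 * (1 / (n : ℝ) ^ 4) := by gcongr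
      _ = _ := by field_simp
  obtain ⟨N, hN⟩ := eventually_atTop.1 hlarge
  set B : ℕ → Set Ω := fun n => if N ≤ n then
    {ω | ENNReal.ofReal (x + 3 * η) < spectralRadius ℂ (randomMatrix (b n) (g n) ω)} else ∅ with hB
  have hsum : ∑' n, P (B n) ≠ ∞ := by
    have hle : ∀ n, P (B n) ≤ ENNReal.ofReal (1 / (n : ℝ) ^ 2) := by
      intro n
      simp only [hB]
      split_ifs with h
      · exact hN n h
      · simp
    refine ne_top_of_le_ne_top ?_ (ENNReal.tsum_le_tsum hle)
    exact (Real.summable_one_div_nat_pow.2 (by norm_num)).tsum_ofReal_ne_top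
  filter_upwards [ae_eventually_notMem hsum] with ω hω
  filter_upwards [hω, eventually_ge_atTop N] with n hn hNn
  simp only [hB, if_pos hNn, Set.mem_ofPred_eq, not_lt] at hn
  exact hn

theorem measure_limsup_spectralRadius_gt {Ω : Type*} [MeasurableSpace Ω] {P : Measure Ω} {K : ℝ}
    (hK : 0 ≤ K) {μ : ℕ → Measure ℂ} (hμ : ∀ n, HasSubGaussianMoments K (μ n))
    {b : (n : ℕ) → Fin n → Fin n → ℂ} {g : (n : ℕ) → Fin n → Fin n → Ω → ℂ}
    (hg : ∀ n, IsIIDArray P (μ n) (g n))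
    (ho : (fun n : ℕ => sigmaStar (b n)) =o[atTop] (fun n : ℕ => 1 / √(Real.log n))) :
    P {ω | limsup (fun n : ℕ => spectralRadius ℂ (randomMatrix (b n) (g n) ω)) atTop >
      limsup (fun n : ℕ => ENNReal.ofReal (sigma (b n))) atTop} = 0 := by
  set ℓ := limsup (fun n : ℕ => ENNReal.ofReal (sigma (b n))) atTop with hℓ
  -- Nothing exceeds an infinite limit superior; a finite one is approached along η = 1/(k+1), a
  -- countable family of null sets.
  rcases eq_or_ne ℓ ⊤ with htop | htop
  · simp [htop]
  obtain ⟨x, hx, hxℓ⟩ : ∃ x : ℝ, 0 ≤ x ∧ ℓ = ENNReal.ofReal x :=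
    ⟨ℓ.toReal, ENNReal.toReal_nonneg, (ENNReal.ofReal_toReal htop).symm⟩
  have hk : ∀ k : ℕ, ∀ᵐ ω ∂P, ∀ᶠ n in atTop,
      spectralRadius ℂ (randomMatrix (b n) (g n) ω) ≤
        ENNReal.ofReal (x + 3 * (1 / ((k : ℝ) + 1))) := by
    intro k
    have hη : (0 : ℝ) < 1 / ((k : ℝ) + 1) := by positivity
    refine ae_eventually_spectralRadius_le hK hμ hg ho hx hη ?_
    have hlt : ℓ < ENNReal.ofReal (x + 1 / ((k : ℝ) + 1)) := by
      rw [hxℓ, ENNReal.ofReal_lt_ofReal_iff (by positivity)]; linarith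
    filter_upwards [eventually_lt_of_limsup_lt hlt] with n hn
    exact ((ENNReal.ofReal_lt_ofReal_iff (by positivity)).1 hn).le
  have hae : ∀ᵐ ω ∂P, ¬ limsup (fun n : ℕ => spectralRadius ℂ (randomMatrix (b n) (g n) ω)) atTop >
      ℓ := by
    filter_upwards [ae_all_iff.2 hk] with ω hω
    rw [gt_iff_lt, not_lt, hxℓ]
    have hlim : Tendsto (fun k : ℕ => ENNReal.ofReal (x + 3 * (1 / ((k : ℝ) + 1)))) atTop
        (𝓝 (ENNReal.ofReal x)) := by
      apply ENNReal.tendsto_ofReal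
      simpa using (tendsto_one_div_add_atTop_nhds_zero_nat (𝕜 := ℝ)).const_mul 3 |>.const_add x
    exact ge_of_tendsto' hlim fun k => limsup_le_of_le (by isBoundedDefault) (hω k)
  simpa [ae_iff] using hae

end SpectralRadiusBound

theorem theorem1p1 (𝓛 : Set (Measure ℂ))
    (h𝓛 : 𝓛 = gaussianLaws ∨
      ∃ K : ℝ, 0 < K ∧ 𝓛 = subGaussianLaws K) :
    -- the non-asymptotic bound on the expected spectral radius
    (∃ C : ℝ, 0 < C ∧
      ∀ (Ω : Type u) [MeasurableSpace Ω] (P : Measure Ω) [IsProbabilityMeasure P]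
        (μ : Measure ℂ) (_ : μ ∈ 𝓛) (n : ℕ) (_ : 1 ≤ n)
        (b : Fin n → Fin n → ℂ) (g : Fin n → Fin n → Ω → ℂ)
        (_ : IsIIDArray P μ g) (ε : ℝ) (_ : 0 < ε),
        ∫⁻ ω, spectralRadius ℂ (randomMatrix b g ω) ∂P ≤
          ENNReal.ofReal
            ((1 + ε) *
              (sigma b +
                6 * sigmaStar b / √(Real.log (1 + ε)) * √(Real.log n)) *
              (1 + C *
                (√(6 * (Real.log n / Real.log (1 + ε))) /
                  √((sigma b / sigmaStar b) ^ 2 +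
                    6 * (Real.log n / Real.log (1 + ε))))))) ∧
    -- almost sure absence of outliers, for matrices of growing size on one probability space
    (∀ (Ω : Type u) [MeasurableSpace Ω] (P : Measure Ω) [IsProbabilityMeasure P]
        (μ : ℕ → Measure ℂ) (_ : ∀ n, μ n ∈ 𝓛)
        (b : (n : ℕ) → Fin n → Fin n → ℂ) (g : (n : ℕ) → Fin n → Fin n → Ω → ℂ)
        (_ : ∀ n, IsIIDArray P (μ n) (g n))
        (_ : (fun n : ℕ => sigmaStar (b n)) =o[atTop]
          (fun n : ℕ => 1 / √(Real.log n))),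
        P {ω | limsup (fun n : ℕ =>
              spectralRadius ℂ (randomMatrix (b n) (g n) ω)) atTop >
            limsup (fun n : ℕ => ENNReal.ofReal (sigma (b n))) atTop} = 0) := by
  obtain ⟨K, hK, hlaw⟩ := exists_hasSubGaussianMoments h𝓛
  refine ⟨⟨momentConst K, momentConst_pos hK.le, ?_⟩, ?_⟩
  · intro Ω _ P _ μ hμ n hn b g hg ε hε
    exact lintegral_spectralRadius_le hK.le (hlaw μ hμ) hg hn hε
  · intro Ω _ P _ μ hμ b g hg ho
    exact measure_limsup_spectralRadius_gt hK.le (fun n => hlaw (μ n) (hμ n)) hg ho
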